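/- **Notation.** Let $\Omega\subseteq\mathbb R^2$ be an open, bounded, connected polygonal Lipschitz domain. A triangulation $\mathcal T$ of $\Omega$ is a finite set of non-degenerate closed triangles with union $\overline\Omega$ such that two different triangles meet in a common edge, a common vertex, or not at all. Let $h_K$, $\rho_K$, $|K|$ be the diameter of $K$, the diameter of its largest inscribed ball and its area, and $\gamma_{\mathcal T}:=\max_{K\in\mathcal T}h_K/\rho_K$. Let $\mathcal E(\cdot)$ denote the set of edges of a mesh or triangle, and $\mathcal E_\Omega(K)$ the set of those edges of $K$ that do not lie in $\partial\Omega$. Each edge $E$ has a unit tangent $\mathbf t_E=(\mathbf z_1-\mathbf z_0)/|\mathbf z_1-\mathbf z_0|$ and a unit normal $\mathbf n_E=(-t_{E,2},t_{E,1})$, given by a fixed numbering $\mathbf z_0,\mathbf z_1$ of its endpoints for which $\mathbf n_E$ points out of $\Omega$ if $E\subseteq\partial\Omega$. For piecewise smooth $u$, let $[\![u]\!]_E$ be $u|_{K_L}-u|_{K_R}$ on interior edges, where $\mathbf n_E$ points from $K_L$ into $K_R$, and $u|_{K_L}$ on boundary edges, with $u|_K$ the continuous extension from the interior of $K$. Let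 $\nabla_{\mathcal T}$ be the piecewise gradient, and let $\Delta$ be applied piecewise. For $k\ge1$, $\operatorname{CR}_{k,0}(\mathcal T)$ is the space of all $v$ that on each $K\in\mathcal T$ are polynomials of total degree at most $k$ and satisfy $\int_E[\![v]\!]_E\,q=0$ for all $E\in\mathcal E(\mathcal T)$ and all polynomials $q$ of degree at most $k-1$. For $f\in L^2(\Omega)$, $v\in\operatorname{CR}_{k,0}(\mathcal T)$ and $\mathcal S\subseteq\mathcal T$ put $$\eta(v;\mathcal S,f)^2:=\sum_{K\in\mathcal S}\Big(|K|\,\|f+\Delta v\|_{L^2(K)}^2+|K|^{1/2}\!\!\sum_{E\in\mathcal E_\Omega(K)}\!\|\langle[\![\nabla_{\mathcal T}v]\!]_E,\mathbf n_E\rangle\|_{L^2(E)}^2+|K|^{1/2}\!\!\sum_{E\in\mathcal E(K)}\!\|\langle[\![\nabla_{\mathcal T}v]\!]_E,\mathbf t_E\rangle\|_{L^2(E)}^2\Big).$$ Let each triangle of an initial triangulation $\mathcal T_0$ carry a marked (newest) vertex, chosen arbitrarily. A newest vertex bisection cuts a triangle along the segment from its newest vertex to the midpoint of the opposite edge, and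 this midpoint becomes the newest vertex of both children. An admissible refinement of a mesh is a conforming mesh obtained from it by finitely many newest vertex bisections, with the marked vertices inherited. Write $\mathbb T(\mathcal T)$ for the set of admissible refinements of $\mathcal T$. **Lemma (Stability).** Let $k\ge1$ be odd and $\gamma\in\mathbb R$. There is a constant $\Lambda_1>0$, depending only on $k$ and $\gamma$, such that for all $\Omega$, all initial triangulations $\mathcal T_0$ of $\Omega$ with $\gamma_{\mathcal T_0}\le\gamma$, all $\mathcal T\in\mathbb T(\mathcal T_0)$ and $\widehat{\mathcal T}\in\mathbb T(\mathcal T)$, all $f\in L^2(\Omega)$, all $v\in\operatorname{CR}_{k,0}(\mathcal T)$ and all $\widehat v\in\operatorname{CR}_{k,0}(\widehat{\mathcal T})$, $$\big|\eta(v;\mathcal T\cap\widehat{\mathcal T},f)-\eta(\widehat v;\mathcal T\cap\widehat{\mathcal T},f)\big|\le\Lambda_1\,\|\nabla_{\mathcal T}v-\nabla_{\widehat{\mathcal T}}\widehat v\|_{\mathbf L^2(\Omega)},$$ where the jumps and gradients in $\eta(v;\cdot,f)$ and $\eta(\widehat v;\cdot,f)$ are those of $\mathcal T$ and of $\widehat{\mathcal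 T}$, respectively. In particular (take $\mathcal T=\mathcal T_0$) the inequality holds for every triangulation $\mathcal T$ and every $\widehat{\mathcal T}\in\mathbb T(\mathcal T)$ with a constant that depends only on $k$ and $\gamma_{\mathcal T}$. -/

import Mathlib

open MeasureTheory Set Filter Topology
open scoped NNReal Classical

noncomputable section

namespace CRFEM

/-- The Euclidean plane. -/
abbrev Pt : Type := EuclideanSpace ℝ (Fin 2)

/-! ### Domains -/

/-- `Ω` lies locally on one side of the graph of a Lipschitz function,
after a rigid motion of the plane. -/
def HasLipschitzBoundary (Ω : Set Pt) : Prop :=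
  ∀ x ∈ frontier Ω, ∃ (e : Pt ≃ᵃⁱ[ℝ] Pt) (L : ℝ≥0) (φ : ℝ → ℝ) (U : Set Pt),
    LipschitzWith L φ ∧ U ∈ 𝓝 x ∧ ∀ y ∈ U, (y ∈ Ω ↔ φ ((e y) 0) < (e y) 1)

/-- Open, bounded, polygonal Lipschitz domains in the plane. -/
structure IsPolygonalLipschitzDomain (Ω : Set Pt) : Prop where
  isOpen : IsOpen Ω
  isConnected : IsConnected Ω
  isBounded : Bornology.IsBounded Ω
  polygonal : ∃ S : Finset (Pt × Pt), frontier Ω = ⋃ p ∈ S, segment ℝ p.1 p.2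
  lipschitz : HasLipschitzBoundary Ω

/-! ### Triangles, edges and triangulations

A closed triangle, or an edge, is encoded by the finite set of its vertices;
the point set itself is the convex hull `hull` of these vertices. -/

/-- The closed triangle (or segment) spanned by a finite set of vertices. -/
def hull (K : Finset Pt) : Set Pt := convexHull ℝ (K : Set Pt)

/-- `K` is the vertex set of a non-degenerate triangle. -/
def IsTriangle (K : Finset Pt) : Prop :=
  K.card = 3 ∧ AffineIndependent ℝ (fun z : K => (z : Pt))

/-- The edges of the triangle `K`. -/
def edgesOf (K : Finset Pt) : Finset (Finset Pt) := K.powersetCard 2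

/-- The edges of a mesh. -/
def edges (T : Finset (Finset Pt)) : Finset (Finset Pt) := T.biUnion edgesOf

/-- Conformity: two triangles of the mesh meet exactly in the hull of their common vertices, so
two different triangles meet in a common edge, in a common vertex, or not at all. -/
def IsConforming (T : Finset (Finset Pt)) : Prop :=
  ∀ K ∈ T, ∀ K' ∈ T, hull K ∩ hull K' = hull (K ∩ K')

/-- `T` is a conforming triangulation of `Ω` into closed triangles. -/
structure IsTriangulation (Ω : Set Pt) (T : Finset (Finset Pt)) : Prop where
  isTriangle : ∀ K ∈ T, IsTriangle K
  conforming : IsConforming T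
  covers : ⋃ K ∈ T, hull K = closure Ω

/-- The diameter `h_K`. -/
def diamK (K : Finset Pt) : ℝ := Metric.diam (hull K)

/-- The diameter `ρ_K` of the largest ball inscribed in the triangle. -/
def inDiam (K : Finset Pt) : ℝ :=
  2 * sSup {r : ℝ | 0 ≤ r ∧ ∃ c : Pt, Metric.closedBall c r ⊆ hull K}

/-- The area `|K|`. -/
def area (K : Finset Pt) : ℝ := (volume : Measure Pt).real (hull K)

/-- The shape-regularity constant `γ_T = max_{K ∈ T} h_K / ρ_K`. -/
def shapeRegularity (T : Finset (Finset Pt)) : ℝ :=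
  sSup ((fun K => diamK K / inDiam K) '' (T : Set (Finset Pt)))

/-- `E` is an edge on the boundary of `Ω`. -/
def IsBoundaryEdge (Ω : Set Pt) (E : Finset Pt) : Prop := hull E ⊆ frontier Ω

/-! ### Newest vertex bisection -/

/-- A mesh in which each triangle carries a marked vertex, its newest vertex; the edge opposite to
it is the refinement edge. Only the values of `newest` on `elements` matter. -/
structure MarkedMesh where
  elements : Finset (Finset Pt)
  newest : Finset Pt → Pt

/-- The marking selects a vertex of each triangle of the mesh. -/
def MarkedMesh.IsMarking (M : MarkedMesh) : Prop := ∀ K ∈ M.elements, M.newest K ∈ K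

/-- One newest vertex bisection: a triangle `{z, a, b}` with newest vertex `z` is replaced by
`{z, a, m}` and `{z, b, m}`, where `m` is the midpoint of `a` and `b`;
`m` is the newest vertex of both children. All other triangles keep their marked vertex. -/
def Bisection (M M' : MarkedMesh) : Prop :=
  ∃ z a b : Pt, ({z, a, b} : Finset Pt) ∈ M.elements ∧ M.newest {z, a, b} = z ∧
    M'.elements = M.elements.erase {z, a, b} ∪ {{z, a, midpoint ℝ a b}, {z, b, midpoint ℝ a b}} ∧
    M'.newest = Function.update
      (Function.update M.newest {z, a, midpoint ℝ a b} (midpoint ℝ a b))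
      {z, b, midpoint ℝ a b} (midpoint ℝ a b)

/-- `M'` is an admissible refinement of `M`: a conforming mesh that is generated from `M` by finitely
many newest vertex bisections. -/
def IsAdmissibleRefinement (M M' : MarkedMesh) : Prop :=
  Relation.ReflTransGen Bisection M M' ∧ IsConforming M'.elements

/-! ### Edge numberings, tangents, normals -/

/-- The unit tangent vector `(z₁ - z₀) / h_E` of an edge with numbered endpoints `(z₀, z₁)`. -/
def tangent (p : Pt × Pt) : Pt := (dist p.1 p.2)⁻¹ • (p.2 - p.1)

/-- The unit normal vector `(-t₂, t₁)`. -/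
def normal (p : Pt × Pt) : Pt := !₂[-(tangent p 1), tangent p 0]

/-- The triangle `K` has the edge `E`, whose numbered endpoints are `p`, and `n_E` points into
`K`. -/
def IsRightOf (p : Pt × Pt) (E K : Finset Pt) : Prop :=
  E ∈ edgesOf K ∧ ∀ w ∈ K \ E, 0 < inner ℝ (w - p.1) (normal p)

/-- The triangle `K` has the edge `E`, whose numbered endpoints are `p`, and `n_E` points out of
`K`. -/
def IsLeftOf (p : Pt × Pt) (E K : Finset Pt) : Prop :=
  E ∈ edgesOf K ∧ ∀ w ∈ K \ E, inner ℝ (w - p.1) (normal p) < 0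

/-- `σ` numbers the endpoints of each edge of the mesh, in such a way that the normal of a boundary
edge points out of the domain, that is, out of the adjacent triangle. -/
structure IsNumbering (Ω : Set Pt) (T : Finset (Finset Pt)) (σ : Finset Pt → Pt × Pt) :
    Prop where
  endpoints : ∀ E ∈ edges T, E = {(σ E).1, (σ E).2}
  outward : ∀ E ∈ edges T, IsBoundaryEdge Ω E →
    ∀ K ∈ T, E ∈ edgesOf K → IsLeftOf (σ E) E K

/-- The integral over the edge with endpoints `p` with respect to arc length. -/
def edgeIntegral (p : Pt × Pt) (g : Pt → ℝ) : ℝ :=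
  dist p.1 p.2 * ∫ s in (0 : ℝ)..1, g (AffineMap.lineMap p.1 p.2 s)

/-! ### Traces and jumps -/

/-- The restriction `u|_K`: the continuous extension to the closed triangle of the restriction of
`u` to the interior. -/
def restr {F : Type*} [TopologicalSpace F] [Nonempty F] (K : Finset Pt) (u : Pt → F) : Pt → F :=
  extendFrom (interior (hull K)) u

/-- The restriction to `E` of `u|_{K_L}`, where `K_L` is the (unique) triangle of the mesh with
edge `E` such that `n_E` points out of it. -/
def leftTrace {F : Type*} [NormedAddCommGroup F] (T : Finset (Finset Pt))
    (σ : Finset Pt → Pt × Pt) (u : Pt → F) (E : Finset Pt) (x : Pt) : F :=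
  ∑ K ∈ T with IsLeftOf (σ E) E K, restr K u x

/-- The restriction to `E` of `u|_{K_R}`, where `K_R` is the (unique) triangle of the mesh with
edge `E` such that `n_E` points into it. -/
def rightTrace {F : Type*} [NormedAddCommGroup F] (T : Finset (Finset Pt))
    (σ : Finset Pt → Pt × Pt) (u : Pt → F) (E : Finset Pt) (x : Pt) : F :=
  ∑ K ∈ T with IsRightOf (σ E) E K, restr K u x

/-- The jump of `u` over the edge `E`. -/
def jump {F : Type*} [NormedAddCommGroup F] (Ω : Set Pt) (T : Finset (Finset Pt))
    (σ : Finset Pt → Pt × Pt) (u : Pt → F) (E : Finset Pt) (x : Pt) : F :=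
  if IsBoundaryEdge Ω E then leftTrace T σ u E x
  else leftTrace T σ u E x - rightTrace T σ u E x

/-! ### Discrete spaces -/

/-- The value of a bivariate polynomial at a point of the plane. -/
def evalPoly (p : MvPolynomial (Fin 2) ℝ) (x : Pt) : ℝ := MvPolynomial.eval (fun i => x i) p

/-- The space `ℙ_k(T)` of piecewise polynomials of total degree at most `k`. As for any function
that is only determined triangle by triangle, the values on the edges play no role. -/
def piecewisePoly (T : Finset (Finset Pt)) (k : ℕ) : Set (Pt → ℝ) :=
  {v | ∀ K ∈ T, ∃ p : MvPolynomial (Fin 2) ℝ, p.totalDegree ≤ k ∧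
    ∀ x ∈ interior (hull K), v x = evalPoly p x}

/-- The Crouzeix--Raviart space `CR_{k,0}(T)`, `1 ≤ k`: piecewise polynomials of degree at most `k`
whose jumps over the interior edges, and whose traces on the boundary edges, are `L²(E)`-orthogonal
to the polynomials of degree at most `k - 1`. -/
def CRZero (Ω : Set Pt) (T : Finset (Finset Pt)) (σ : Finset Pt → Pt × Pt) (k : ℕ) :
    Set (Pt → ℝ) :=
  {v | v ∈ piecewisePoly T k ∧ ∀ E ∈ edges T, ∀ q : MvPolynomial (Fin 2) ℝ,
    q.totalDegree ≤ k - 1 →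
      edgeIntegral (σ E) (fun x => jump Ω T σ v E x * evalPoly q x) = 0}

/-- The piecewise gradient `∇_T v`, which is the gradient in the interior of each triangle and is
set to zero elsewhere. -/
def brokenGrad (T : Finset (Finset Pt)) (v : Pt → ℝ) : Pt → Pt :=
  Set.indicator (⋃ K ∈ T, interior (hull K)) (gradient v)

/-- The norm of `L²(Ω)`, for vector fields. -/
def l2Norm (Ω : Set Pt) (w : Pt → Pt) : ℝ := Real.sqrt (∫ x in Ω, ‖w x‖ ^ 2)

/-! ### The residual error estimator -/

/-- The square of `μ(v; K, f)`: volume residual and normal jumps over interior edges. -/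
def muSq (Ω : Set Pt) (T : Finset (Finset Pt)) (σ : Finset Pt → Pt × Pt) (f v : Pt → ℝ)
    (K : Finset Pt) : ℝ :=
  area K * (∫ x in interior (hull K), (f x + Laplacian.laplacian v x) ^ 2)
    + Real.sqrt (area K) * ∑ E ∈ edgesOf K with ¬ IsBoundaryEdge Ω E,
        edgeIntegral (σ E)
          (fun x => (inner ℝ (jump Ω T σ (brokenGrad T v) E x) (normal (σ E))) ^ 2)

/-- The square of `ν(v; K)`: tangential jumps over all edges. -/
def nuSq (Ω : Set Pt) (T : Finset (Finset Pt)) (σ : Finset Pt → Pt × Pt) (v : Pt → ℝ)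
    (K : Finset Pt) : ℝ :=
  Real.sqrt (area K) * ∑ E ∈ edgesOf K,
    edgeIntegral (σ E)
      (fun x => (inner ℝ (jump Ω T σ (brokenGrad T v) E x) (tangent (σ E))) ^ 2)

/-- The error estimator `η(v; S, f)` of the mesh `T` on a subset `S` of its triangles. -/
def eta (Ω : Set Pt) (T : Finset (Finset Pt)) (σ : Finset Pt → Pt × Pt) (f v : Pt → ℝ)
    (S : Finset (Finset Pt)) : ℝ :=
  Real.sqrt (∑ K ∈ S, (muSq Ω T σ f v K + nuSq Ω T σ v K))

end CRFEM

end

noncomputable section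

namespace CRFEM

/-! ### Polynomials on the plane -/

/-! On the common triangles both estimators are square roots of sums of weighted squared $L^2$
norms. The reverse triangle inequality, organised by `SqClose`, therefore leaves only the
differences to be estimated: $f$ cancels, and there remain the Laplacian of $v-\widehat v$ and the
differences of the gradient jumps, to be bounded by $w=\nabla_{\mathcal
T}v-\nabla_{\widehat{\mathcal T}}\widehat v$.

The Laplacian is controlled by the inverse estimate $|K|\,\|\Delta r\|_K^2\lesssim\|\nabla r\|_K^2$
for polynomials $r$ (`exists_laplacian_bound`), the jumps by a discrete trace inequality
(`exists_trace_bound`). Both follow from finite dimensionality on a reference triangle and affine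
scaling (`exists_pointwise_bound`).

The geometric point is `exists_jump_bound`. Let $E$ be an edge of a common triangle $K$. Since $K$
is not refined and the meshes are conforming, $E$ is not split: the fine triangle $\widehat K_2$
across $E$ has the full edge $E$ and lies in the coarse triangle $K_2$ across $E$. The difference of
the jumps is thus made of traces of $w$ from $K$ and from $\widehat K_2$, on each of which $w$ is
one polynomial gradient. A triangle occurs as such a neighbour at most once for each of its edges,
so summation gives $\|w\|_{L^2(\Omega)}^2$ up to a constant.

The constants are uniform because newest vertex bisection preserves shape regularity: in affine
coordinates in which an initial triangle is right isosceles with the right angle at its marked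
vertex, every descendant is again of this form (`isSkewIsosceles_children`). -/

theorem totalDegree_pderiv_le (i : Fin 2) {k : ℕ} {p : MvPolynomial (Fin 2) ℝ}
    (hp : p.totalDegree ≤ k) : (MvPolynomial.pderiv i p).totalDegree ≤ k := by
  conv_lhs => rw [p.as_sum, map_sum]
  refine (MvPolynomial.totalDegree_finsetSum _ _).trans (Finset.sup_le fun m hm => ?_)
  rw [MvPolynomial.pderiv_monomial]
  refine (MvPolynomial.totalDegree_monomial_le _ _).trans ?_
  refine le_trans ?_ ((MvPolynomial.le_totalDegree hm).trans hp)
  rw [Finsupp.sum_fintype _ _ (fun _ => rfl), Finsupp.sum_fintype _ _ (fun _ => rfl)]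
  exact Finset.sum_le_sum fun j _ => by simp

theorem totalDegree_bind₁_le {f : Fin 2 → MvPolynomial (Fin 2) ℝ}
    (hf : ∀ i, (f i).totalDegree ≤ 1) {k : ℕ} {p : MvPolynomial (Fin 2) ℝ}
    (hp : p.totalDegree ≤ k) : (MvPolynomial.bind₁ f p).totalDegree ≤ k := by
  conv_lhs => rw [p.as_sum, map_sum]
  refine (MvPolynomial.totalDegree_finsetSum _ _).trans (Finset.sup_le fun m hm => ?_)
  rw [MvPolynomial.bind₁_monomial]
  refine (MvPolynomial.totalDegree_mul _ _).trans ?_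
  rw [MvPolynomial.totalDegree_C, zero_add]
  refine le_trans ?_ ((MvPolynomial.le_totalDegree hm).trans hp)
  refine (MvPolynomial.totalDegree_finsetProd _ _).trans ?_
  refine Finset.sum_le_sum fun j _ => ?_
  refine (MvPolynomial.totalDegree_pow _ _).trans ?_
  have := Nat.mul_le_mul_left (m j) (hf j)
  simpa using this

theorem pderiv_bind₁ (f : Fin 2 → MvPolynomial (Fin 2) ℝ) (j : Fin 2)
    (p : MvPolynomial (Fin 2) ℝ) :
    MvPolynomial.pderiv j (MvPolynomial.bind₁ f p) =
      ∑ i, MvPolynomial.bind₁ f (MvPolynomial.pderiv i p) * MvPolynomial.pderiv j (f i) := by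
  induction p using MvPolynomial.induction_on with
  | C a => simp
  | add p q hp hq => simp only [map_add, hp, hq, add_mul, Finset.sum_add_distrib]
  | mul_X p n hp =>
    simp only [map_mul, MvPolynomial.bind₁_X_right, Derivation.leibniz, hp, smul_eq_mul,
      MvPolynomial.pderiv_X, map_add, Fin.sum_univ_two]
    fin_cases n <;> simp <;> ring

theorem continuous_evalPoly (p : MvPolynomial (Fin 2) ℝ) : Continuous (evalPoly p) :=
  (MvPolynomial.continuous_eval p).comp (by fun_prop)

@[simp] theorem evalPoly_sub (p q : MvPolynomial (Fin 2) ℝ) (x : Pt) :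
    evalPoly (p - q) x = evalPoly p x - evalPoly q x := by simp [evalPoly]

@[simp] theorem evalPoly_add (p q : MvPolynomial (Fin 2) ℝ) (x : Pt) :
    evalPoly (p + q) x = evalPoly p x + evalPoly q x := by simp [evalPoly]

/-- The gradient of a polynomial. -/
def gradPoly (p : MvPolynomial (Fin 2) ℝ) (x : Pt) : Pt :=
  !₂[evalPoly (MvPolynomial.pderiv 0 p) x, evalPoly (MvPolynomial.pderiv 1 p) x]

/-- The Laplacian of a polynomial. -/
def lapPoly (p : MvPolynomial (Fin 2) ℝ) : MvPolynomial (Fin 2) ℝ :=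
  ∑ i, MvPolynomial.pderiv i (MvPolynomial.pderiv i p)

theorem continuous_gradPoly (p : MvPolynomial (Fin 2) ℝ) : Continuous (gradPoly p) := by
  unfold gradPoly
  have h0 := continuous_evalPoly (MvPolynomial.pderiv 0 p)
  have h1 := continuous_evalPoly (MvPolynomial.pderiv 1 p)
  refine (PiLp.continuous_toLp 2 _).comp (continuous_pi fun i => ?_)
  fin_cases i <;> simpa

theorem gradPoly_sub (p q : MvPolynomial (Fin 2) ℝ) (x : Pt) :
    gradPoly (p - q) x = gradPoly p x - gradPoly q x := by
  ext i; fin_cases i <;> simp [gradPoly]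

theorem norm_gradPoly_sq (p : MvPolynomial (Fin 2) ℝ) (x : Pt) :
    ‖gradPoly p x‖ ^ 2 = ∑ i, evalPoly (MvPolynomial.pderiv i p) x ^ 2 := by
  simp [gradPoly, EuclideanSpace.norm_sq_eq]

theorem hasGradientAt_evalPoly (p : MvPolynomial (Fin 2) ℝ) (x : Pt) :
    HasGradientAt (evalPoly p) (gradPoly p x) x := by
  rw [hasGradientAt_iff_hasFDerivAt]
  induction p using MvPolynomial.induction_on with
  | C a =>
    have : gradPoly (MvPolynomial.C a) x = 0 := by
      ext i; fin_cases i <;> simp [gradPoly, evalPoly]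
    rw [this, map_zero]
    have h : evalPoly (MvPolynomial.C a) = fun _ => a := by ext; simp [evalPoly]
    rw [h]; exact hasFDerivAt_const a x
  | add p q hp hq =>
    have h : evalPoly (p + q) = evalPoly p + evalPoly q := by ext; simp
    have h2 : gradPoly (p + q) x = gradPoly p x + gradPoly q x := by
      ext i; fin_cases i <;> simp [gradPoly]
    rw [h, h2, map_add]; exact hp.add hq
  | mul_X p n hp =>
    have h : evalPoly (p * MvPolynomial.X n) = fun y => evalPoly p y * y n := by
      ext; simp [evalPoly]
    rw [h]
    have hn : HasFDerivAt (fun y : Pt => y n) (EuclideanSpace.proj n : Pt →L[ℝ] ℝ) x :=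
      (EuclideanSpace.proj n : Pt →L[ℝ] ℝ).hasFDerivAt
    refine (hp.mul hn).congr_fderiv ?_
    ext y
    fin_cases n <;>
    simp [gradPoly, evalPoly, PiLp.inner_apply, MvPolynomial.pderiv_X, Derivation.leibniz] <;> ring

theorem gradient_evalPoly (p : MvPolynomial (Fin 2) ℝ) (x : Pt) :
    gradient (evalPoly p) x = gradPoly p x := (hasGradientAt_evalPoly p x).gradient

theorem contDiff_evalPoly (p : MvPolynomial (Fin 2) ℝ) : ContDiff ℝ ⊤ (evalPoly p) := by
  induction p using MvPolynomial.induction_on with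
  | C a =>
    have h : evalPoly (MvPolynomial.C a) = fun _ => a := by ext; simp [evalPoly]
    rw [h]; exact contDiff_const
  | add p q hp hq =>
    have h : evalPoly (p + q) = evalPoly p + evalPoly q := by ext; simp
    rw [h]; exact hp.add hq
  | mul_X p n hp =>
    have h : evalPoly (p * MvPolynomial.X n) = fun y => evalPoly p y * y n := by
      ext; simp [evalPoly]
    rw [h]
    exact hp.mul (EuclideanSpace.proj n : Pt →L[ℝ] ℝ).contDiff

theorem fderiv_evalPoly_single (p : MvPolynomial (Fin 2) ℝ) (i : Fin 2) (x : Pt) :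
    fderiv ℝ (evalPoly p) x (EuclideanSpace.single i 1) = evalPoly (MvPolynomial.pderiv i p) x := by
  rw [(hasGradientAt_evalPoly p x).hasFDerivAt.fderiv]
  fin_cases i <;> simp [gradPoly, EuclideanSpace.inner_single_right]

theorem laplacian_evalPoly (p : MvPolynomial (Fin 2) ℝ) (x : Pt) :
    Laplacian.laplacian (evalPoly p) x = evalPoly (lapPoly p) x := by
  rw [InnerProductSpace.laplacian_eq_iteratedFDeriv_orthonormalBasis _
    (EuclideanSpace.basisFun (Fin 2) ℝ)]
  have key : ∀ i : Fin 2, iteratedFDeriv ℝ 2 (evalPoly p) x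
      ![EuclideanSpace.single i 1, EuclideanSpace.single i 1] =
      evalPoly (MvPolynomial.pderiv i (MvPolynomial.pderiv i p)) x := by
    intro i
    rw [iteratedFDeriv_two_apply]
    have hd : DifferentiableAt ℝ (fderiv ℝ (evalPoly p)) x :=
      ((contDiff_evalPoly p).fderiv_right (m := 1) (by exact le_top)).differentiable (by simp) x
    have h2 : (fun y => fderiv ℝ (evalPoly p) y (EuclideanSpace.single i 1)) =
      evalPoly (MvPolynomial.pderiv i p) := by ext y; exact fderiv_evalPoly_single p i y
    have h3 := (hd.hasFDerivAt.clm_apply (hasFDerivAt_const (EuclideanSpace.single i (1:ℝ)) x)).fderiv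
    rw [← fderiv_evalPoly_single, ← h2, h3]
    simp
  simp [key, lapPoly, evalPoly]

/-! ### The plane in affine coordinates -/

/-- The determinant of two plane vectors. -/
def cross (u w : Pt) : ℝ := u 0 * w 1 - u 1 * w 0

@[simp] theorem cross_self (u : Pt) : cross u u = 0 := by simp [cross]; ring

theorem normSq_eq (u : Pt) : ‖u‖ ^ 2 = u 0 ^ 2 + u 1 ^ 2 := by
  simp [EuclideanSpace.norm_sq_eq]

/-- The linear map that sends the coordinate vectors to `u` and `w`. -/
def coordMap (u w : Pt) : Pt →ₗ[ℝ] Pt where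
  toFun x := x 0 • u + x 1 • w
  map_add' x y := by simp [add_smul]; abel
  map_smul' r x := by simp [mul_smul]

theorem coordMap_apply (u w x : Pt) : coordMap u w x = x 0 • u + x 1 • w := rfl

theorem det_coordMap (u w : Pt) : LinearMap.det (coordMap u w) = cross u w := by
  rw [← LinearMap.det_toMatrix (EuclideanSpace.basisFun (Fin 2) ℝ).toBasis, Matrix.det_fin_two]
  simp [LinearMap.toMatrix_apply, coordMap_apply, cross]
  ring

/-- The affine coordinates with origin `a` and axes towards `b` and `c`. -/
def chart (a b c x : Pt) : Pt := a + coordMap (b - a) (c - a) x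

theorem chart_apply (a b c x : Pt) : chart a b c x = a + (x 0 • (b - a) + x 1 • (c - a)) := rfl

theorem hasFDerivAt_chart (a b c x : Pt) :
    HasFDerivAt (chart a b c) (coordMap (b - a) (c - a)).toContinuousLinearMap x :=
  ((coordMap (b - a) (c - a)).toContinuousLinearMap.hasFDerivAt).const_add a

theorem coordMap_bijective {u w : Pt} (h : cross u w ≠ 0) : Function.Bijective (coordMap u w) := by
  rw [← det_coordMap] at h
  exact (LinearMap.equivOfDetNeZero (coordMap u w) h).bijective

theorem chart_injective {a b c : Pt} (h : cross (b - a) (c - a) ≠ 0) :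
    Function.Injective (chart a b c) := fun _ _ hxy =>
  (coordMap_bijective h).1 (add_left_cancel hxy)

theorem isOpenMap_chart {a b c : Pt} (h : cross (b - a) (c - a) ≠ 0) :
    IsOpenMap (chart a b c) :=
  (isOpenMap_add_left a).comp
    ((coordMap (b - a) (c - a)).isOpenMap_of_finiteDimensional (coordMap_bijective h).2)

/-- The reference triangle. -/
def refTriangle : Set Pt := {x | 0 ≤ x 0 ∧ 0 ≤ x 1 ∧ x 0 + x 1 ≤ 1}

/-- An open square in the reference triangle. -/
def refSquare : Set Pt := {x | ∀ i, x i ∈ Ioo (0 : ℝ) (1 / 2)}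

/-- Nondegeneracy is not required, so segments are covered as well, written as `{p, q, q}`. -/
theorem hull_triple (a b c : Pt) : hull {a, b, c} = chart a b c '' refTriangle := by
  ext x
  simp only [hull, Finset.coe_insert, Finset.coe_singleton]
  constructor
  · intro hx
    rw [convexHull_insert (by simp), convexHull_pair] at hx
    simp only [segment_eq_image, mem_convexJoin, mem_singleton_iff, exists_eq_left, mem_image] at hx
    obtain ⟨y, ⟨t, ⟨ht0, ht1⟩, rfl⟩, s, ⟨hs0, hs1⟩, rfl⟩ := hx
    -- The point is $(1-s)a+s((1-t)b+tc)$, whose coordinates along $b-a$ and $c-a$ are $s(1-t)$ and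
    -- $st$.
    refine ⟨!₂[s * (1 - t), s * t], ?_, ?_⟩
    · refine ⟨?_, ?_, ?_⟩ <;> simp
      · exact mul_nonneg hs0 (by linarith)
      · positivity
      · linarith
    · rw [chart_apply]
      ext i; simp; ring
  · rintro ⟨y, ⟨h0, h1, h2⟩, rfl⟩
    have ha : a ∈ convexHull ℝ ({a, b, c} : Set Pt) := subset_convexHull _ _ (by simp)
    have hb : b ∈ convexHull ℝ ({a, b, c} : Set Pt) := subset_convexHull _ _ (by simp)
    have hc : c ∈ convexHull ℝ ({a, b, c} : Set Pt) := subset_convexHull _ _ (by simp)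
    have hcv := convex_convexHull ℝ ({a, b, c} : Set Pt)
    have := hcv.sum_mem (t := (Finset.univ : Finset (Fin 3)))
      (w := ![1 - y 0 - y 1, y 0, y 1]) (z := ![a, b, c])
      (by intro i _; fin_cases i <;> simp <;> linarith)
      (by simp [Fin.sum_univ_three]; ring) (by intro i _; fin_cases i <;> simpa)
    convert this using 1
    rw [chart_apply]
    ext i; simp [Fin.sum_univ_three]; ring

theorem refSquare_subset : refSquare ⊆ refTriangle := by
  intro x hx
  have h0 := hx 0
  have h1 := hx 1
  exact ⟨h0.1.le, h1.1.le, by linarith [h0.2, h1.2]⟩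

theorem isOpen_refSquare : IsOpen refSquare := by
  simp only [refSquare, ofPred_forall]
  exact isOpen_iInter_of_finite fun i => isOpen_Ioo.preimage (by fun_prop)

theorem refTriangle_subset_closedBall : refTriangle ⊆ Metric.closedBall 0 1 := by
  rintro x ⟨h0, h1, h2⟩
  rw [mem_closedBall_zero_iff]
  have : ‖x‖ ^ 2 ≤ 1 := by rw [normSq_eq]; nlinarith
  nlinarith [norm_nonneg x]

theorem isClosed_refTriangle : IsClosed refTriangle := by
  have h0 : IsClosed {x : Pt | 0 ≤ x 0} := isClosed_le continuous_const (by fun_prop)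
  have h1 : IsClosed {x : Pt | 0 ≤ x 1} := isClosed_le continuous_const (by fun_prop)
  have h2 : IsClosed {x : Pt | x 0 + x 1 ≤ 1} := isClosed_le (by fun_prop) continuous_const
  exact h0.inter (h1.inter h2)

theorem isCompact_refTriangle : IsCompact refTriangle :=
  (isCompact_closedBall 0 1).of_isClosed_subset isClosed_refTriangle refTriangle_subset_closedBall

/-- The area of a triangle is proportional to the determinant of its edge vectors. -/
theorem area_triple (a b c : Pt) :
    area {a, b, c} = |cross (b - a) (c - a)| * (volume : Measure Pt).real refTriangle := by
  have : chart a b c '' refTriangle =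
      (fun x => a + x) '' (coordMap (b - a) (c - a) '' refTriangle) := by
    rw [image_image]; rfl
  rw [area, hull_triple, this, Measure.real, image_add_left, measure_preimage_add,
    Measure.addHaar_image_linearMap, ENNReal.toReal_mul, det_coordMap]
  simp [Measure.real]

theorem refSquare_image_subset_interior {a b c : Pt} (h : cross (b - a) (c - a) ≠ 0) :
    chart a b c '' refSquare ⊆ interior (hull {a, b, c}) := by
  refine interior_maximal ?_ (isOpenMap_chart h _ isOpen_refSquare)
  rw [hull_triple]; exact image_mono refSquare_subset

theorem refSquare_nonempty : refSquare.Nonempty :=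
  ⟨!₂[1 / 4, 1 / 4], fun i => by fin_cases i <;> norm_num⟩

theorem interior_hull_nonempty {a b c : Pt} (h : cross (b - a) (c - a) ≠ 0) :
    (interior (hull {a, b, c})).Nonempty :=
  (refSquare_nonempty.image _).mono (refSquare_image_subset_interior h)

theorem convex_hull (K : Finset Pt) : Convex ℝ (hull K) := convex_convexHull ℝ _

theorem isCompact_hull (K : Finset Pt) : IsCompact (hull K) :=
  K.finite_toSet.isCompact_convexHull (𝕜 := ℝ)

theorem integrableOn_interior_hull (K : Finset Pt) {g : Pt → ℝ} (hg : Continuous g) :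
    IntegrableOn g (interior (hull K)) :=
  (hg.continuousOn.integrableOn_compact (isCompact_hull K)).mono_set interior_subset

/-- The integral over the triangle dominates the pulled back integral over the reference square. -/
theorem integral_refSquare_le {a b c : Pt} (h : cross (b - a) (c - a) ≠ 0) {g : Pt → ℝ}
    (hg : Continuous g) (h0 : ∀ x, 0 ≤ g x) :
    |cross (b - a) (c - a)| * ∫ x in refSquare, g (chart a b c x) ≤
      ∫ x in interior (hull {a, b, c}), g x := by
  have h1 := integral_image_eq_integral_abs_det_fderiv_smul volume isOpen_refSquare.measurableSet
    (fun x _ => (hasFDerivAt_chart a b c x).hasFDerivWithinAt) (chart_injective h).injOn g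
  have h2 : ContinuousLinearMap.det (coordMap (b - a) (c - a)).toContinuousLinearMap =
    cross (b - a) (c - a) := by
      rw [← det_coordMap]; rfl
  simp only [h2, smul_eq_mul, integral_const_mul] at h1
  rw [← h1]
  exact setIntegral_mono_set (integrableOn_interior_hull _ hg) (ae_of_all _ h0)
    (refSquare_image_subset_interior h).eventuallyLE

/-! ### Inverse and trace inequalities -/

theorem memLp_restrict_of_continuous {F : Type*} [NormedAddCommGroup F] {g : Pt → F}
    (hg : Continuous g) {S : Set Pt} (hS : IsCompact S) :
    MemLp g 2 (volume.restrict S) := by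
  have : IsFiniteMeasure ((volume : Measure Pt).restrict S) := ⟨by simpa using hS.measure_lt_top⟩
  obtain ⟨C, hC⟩ := hS.exists_bound_of_continuousOn hg.continuousOn
  exact MemLp.of_bound (hg.continuousOn.aestronglyMeasurable_of_isCompact hS hS.measurableSet) C
    ((ae_restrict_iff' hS.measurableSet).2 (ae_of_all _ hC))

theorem memLp_evalPoly_refSquare (p : MvPolynomial (Fin 2) ℝ) :
    MemLp (evalPoly p) 2 (volume.restrict refSquare) :=
  (memLp_restrict_of_continuous (continuous_evalPoly p) isCompact_refTriangle).mono_measure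
    (Measure.restrict_mono refSquare_subset le_rfl)

/-- The embedding of the polynomials into `L²` of the reference square. -/
def refLp : MvPolynomial (Fin 2) ℝ →ₗ[ℝ] Lp ℝ 2 (volume.restrict refSquare) where
  toFun p := (memLp_evalPoly_refSquare p).toLp
  map_add' p q := by
    rw [← MemLp.toLp_add]; congr 1; ext; simp
  map_smul' r p := by
    rw [RingHom.id_apply, ← MemLp.toLp_const_smul]; congr 1; ext; simp [evalPoly]

/-- A continuous function that vanishes a.e. on an open set vanishes on it, and a polynomial is
determined by its values on a product of infinite sets. The product structure is the advantage of
the square over the triangle. -/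
theorem refLp_injective : Function.Injective refLp := by
  rw [← LinearMap.ker_eq_bot, LinearMap.ker_eq_bot']
  intro p hp
  have h1 : evalPoly p =ᵐ[volume.restrict refSquare] (0 : Pt → ℝ) := by
    have h2 := (memLp_evalPoly_refSquare p).coeFn_toLp
    have h3 : (memLp_evalPoly_refSquare p).toLp = 0 := hp
    rw [h3] at h2
    exact h2.symm.trans (Lp.coeFn_zero _ _ _)
  have h2 := Measure.eqOn_open_of_ae_eq h1 isOpen_refSquare (continuous_evalPoly p).continuousOn
    continuousOn_const
  refine MvPolynomial.funext_set (s := fun _ => Ioo (0 : ℝ) (1 / 2))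
    (fun _ => Ioo_infinite (by norm_num)) fun x hx => ?_
  have := h2 (x := WithLp.toLp 2 x) (fun i => hx i (mem_univ i))
  simpa [evalPoly] using this

theorem norm_refLp_sq (p : MvPolynomial (Fin 2) ℝ) :
    ‖refLp p‖ ^ 2 = ∫ x in refSquare, evalPoly p x ^ 2 := by
  rw [← real_inner_self_eq_norm_sq, L2.inner_def]
  refine integral_congr_ae ?_
  filter_upwards [(memLp_evalPoly_refSquare p).coeFn_toLp] with x hx
  have : (refLp p) x = evalPoly p x := hx
  simp [this, sq]

/-- Restriction of polynomials to the reference triangle. -/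
def refRestrict : MvPolynomial (Fin 2) ℝ →ₗ[ℝ] C(refTriangle, ℝ) where
  toFun p := ⟨fun x => evalPoly p x, (continuous_evalPoly p).comp continuous_subtype_val⟩
  map_add' p q := by ext; simp
  map_smul' r p := by ext; simp [evalPoly]

/-- On polynomials of bounded degree, any linear map is bounded with respect to `L²`. -/
theorem exists_bound_refLp (k : ℕ) {F : Type*} [NormedAddCommGroup F] [NormedSpace ℝ F]
    (B : MvPolynomial (Fin 2) ℝ →ₗ[ℝ] F) :
    ∃ C : ℝ, 0 ≤ C ∧ ∀ p : MvPolynomial (Fin 2) ℝ, p.totalDegree ≤ k →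
      ‖B p‖ ^ 2 ≤ C * ∫ x in refSquare, evalPoly p x ^ 2 := by
  let V := MvPolynomial.restrictTotalDegree (Fin 2) ℝ k
  have hinj : Function.Injective (refLp.domRestrict V) :=
    refLp_injective.comp Subtype.val_injective
  let e := LinearEquiv.ofInjective (refLp.domRestrict V) hinj
  -- The image of the polynomials of degree at most `k` in $L^2$ is finite-dimensional, so every
  -- linear map on it is continuous.
  let g := (B.domRestrict V ∘ₗ e.symm.toLinearMap).toContinuousLinearMap
  refine ⟨‖g‖ ^ 2, by positivity, fun p hp => ?_⟩
  have hp' : p ∈ V := (MvPolynomial.mem_restrictTotalDegree _ _ _).2 hp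
  have h1 : g (e ⟨p, hp'⟩) = B p := by simp [g]
  have h2 := g.le_opNorm (e ⟨p, hp'⟩)
  have h3 : ‖e ⟨p, hp'⟩‖ = ‖refLp p‖ := rfl
  rw [h1, h3] at h2
  rw [← norm_refLp_sq, ← mul_pow]
  gcongr

/-- `exists_bound_refLp` is applied to the restriction to the compact reference triangle, with the
sup norm, and to its compositions with the partial derivatives. -/
theorem exists_ref_bound (k : ℕ) :
    ∃ C : ℝ, 0 < C ∧ ∀ p : MvPolynomial (Fin 2) ℝ, p.totalDegree ≤ k → ∀ x ∈ refTriangle,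
      evalPoly p x ^ 2 ≤ C * ∫ x in refSquare, evalPoly p x ^ 2 ∧
      ∀ i, evalPoly (MvPolynomial.pderiv i p) x ^ 2 ≤
        C * ∫ x in refSquare, evalPoly p x ^ 2 := by
  have : CompactSpace refTriangle := isCompact_iff_compactSpace.1 isCompact_refTriangle
  obtain ⟨C, hC, h⟩ := exists_bound_refLp k refRestrict
  have hd := fun i : Fin 2 => exists_bound_refLp k
    (refRestrict ∘ₗ (MvPolynomial.pderiv (R := ℝ) i).toLinearMap)
  choose D hD hd using hd
  have key : ∀ (q : MvPolynomial (Fin 2) ℝ), ∀ x ∈ refTriangle,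
      evalPoly q x ^ 2 ≤ ‖refRestrict q‖ ^ 2 := fun q x hx =>
    sq_le_sq' (neg_le_of_abs_le ((refRestrict q).norm_coe_le_norm ⟨x, hx⟩))
      (le_of_abs_le ((refRestrict q).norm_coe_le_norm ⟨x, hx⟩))
  refine ⟨C + D 0 + D 1 + 1, by linarith [hD 0, hD 1], fun p hp x hx => ?_⟩
  have hI : 0 ≤ ∫ x in refSquare, evalPoly p x ^ 2 := integral_nonneg fun _ => sq_nonneg _
  refine ⟨((key p x hx).trans (h p hp)).trans ?_, fun i =>
    ((key _ x hx).trans (hd i p hp)).trans ?_⟩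
  · exact mul_le_mul_of_nonneg_right (by linarith [hD 0, hD 1]) hI
  · refine mul_le_mul_of_nonneg_right ?_ hI
    fin_cases i <;> simp <;> linarith [hD 0, hD 1]

/-- The substitution of the affine coordinates of a triangle. -/
def chartPoly (a b c : Pt) (i : Fin 2) : MvPolynomial (Fin 2) ℝ :=
  MvPolynomial.C (a i) + (MvPolynomial.C ((b - a) i) * MvPolynomial.X 0 +
    MvPolynomial.C ((c - a) i) * MvPolynomial.X 1)

theorem totalDegree_chartPoly_le (a b c : Pt) (i : Fin 2) :
    (chartPoly a b c i).totalDegree ≤ 1 := by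
  have h : ∀ (r : ℝ) (j : Fin 2),
      (MvPolynomial.C r * MvPolynomial.X j : MvPolynomial (Fin 2) ℝ).totalDegree ≤ 1 := fun r j =>
    (MvPolynomial.totalDegree_mul _ _).trans (by simp)
  refine (MvPolynomial.totalDegree_add _ _).trans (max_le (by simp) ?_)
  exact (MvPolynomial.totalDegree_add _ _).trans (max_le (h _ _) (h _ _))

theorem evalPoly_bind₁_chartPoly (a b c : Pt) (p : MvPolynomial (Fin 2) ℝ) (x : Pt) :
    evalPoly (MvPolynomial.bind₁ (chartPoly a b c) p) x = evalPoly p (chart a b c x) := by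
  rw [evalPoly, MvPolynomial.eval, MvPolynomial.eval₂Hom_bind₁, evalPoly, MvPolynomial.eval]
  congr 2
  ext i
  simp [chartPoly, chart_apply]
  ring

theorem evalPoly_pderiv_bind₁_chartPoly (a b c : Pt) (p : MvPolynomial (Fin 2) ℝ) (x : Pt) :
    (evalPoly (MvPolynomial.pderiv 0 (MvPolynomial.bind₁ (chartPoly a b c) p)) x =
      ∑ i, evalPoly (MvPolynomial.pderiv i p) (chart a b c x) * (b - a) i) ∧
    (evalPoly (MvPolynomial.pderiv 1 (MvPolynomial.bind₁ (chartPoly a b c) p)) x =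
      ∑ i, evalPoly (MvPolynomial.pderiv i p) (chart a b c x) * (c - a) i) := by
  have hmul : ∀ (p q : MvPolynomial (Fin 2) ℝ), evalPoly (p * q) x = evalPoly p x * evalPoly q x :=
    fun p q => by simp [evalPoly]
  have h0 : ∀ i, evalPoly (MvPolynomial.pderiv 0 (chartPoly a b c i)) x = (b - a) i := fun i => by
    simp [chartPoly, evalPoly, MvPolynomial.pderiv_X, Derivation.leibniz]
  have h1 : ∀ i, evalPoly (MvPolynomial.pderiv 1 (chartPoly a b c i)) x = (c - a) i := fun i => by
    simp [chartPoly, evalPoly, MvPolynomial.pderiv_X, Derivation.leibniz]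
  simp only [pderiv_bind₁, Fin.sum_univ_two, evalPoly_add, hmul, evalPoly_bind₁_chartPoly, h0, h1]
  exact ⟨trivial, trivial⟩

/-- Cramer's rule recovers the gradient `(P0, P1)` from its products with the edge vectors `U` and
`W`, which are the derivatives on the reference triangle. The Cauchy–Schwarz inequality bounds the
numerators. -/
theorem cramer_bound {P0 P1 U0 U1 W0 W1 D M : ℝ} (hD : D = U0 * W1 - U1 * W0)
    (g0 : (P0 * U0 + P1 * U1) ^ 2 ≤ M) (g1 : (P0 * W0 + P1 * W1) ^ 2 ≤ M) :
    D ^ 2 * P0 ^ 2 ≤ (U0 ^ 2 + U1 ^ 2 + (W0 ^ 2 + W1 ^ 2)) * (2 * M) ∧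
      D ^ 2 * P1 ^ 2 ≤ (U0 ^ 2 + U1 ^ 2 + (W0 ^ 2 + W1 ^ 2)) * (2 * M) := by
  set R0 := P0 * U0 + P1 * U1
  set R1 := P0 * W0 + P1 * W1
  have c0 : D * P0 = W1 * R0 - U1 * R1 := by simp only [hD, R0, R1]; ring
  have c1 : D * P1 = U0 * R1 - W0 * R0 := by simp only [hD, R0, R1]; ring
  have hM : 0 ≤ M := (sq_nonneg _).trans g0
  have main : ∀ s t N : ℝ, s ^ 2 + t ^ 2 ≤ N → (s * R0 - t * R1) ^ 2 ≤ N * (2 * M) := by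
    intro s t N hN
    calc (s * R0 - t * R1) ^ 2 ≤ (s ^ 2 + t ^ 2) * (R0 ^ 2 + R1 ^ 2) := by
          linarith [sq_nonneg (s * R1 + t * R0)]
      _ ≤ N * (2 * M) := by
          gcongr
          · exact (add_nonneg (sq_nonneg s) (sq_nonneg t)).trans hN
          · linarith
  rw [← mul_pow, ← mul_pow, c0, c1]
  refine ⟨main _ _ _ ?_, ?_⟩
  · linarith [sq_nonneg U0, sq_nonneg W0]
  · have := main (-W0) (-U0) (U0 ^ 2 + U1 ^ 2 + (W0 ^ 2 + W1 ^ 2))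
      (by linarith [sq_nonneg U1, sq_nonneg W1])
    rwa [show -W0 * R0 - -U0 * R1 = U0 * R1 - W0 * R0 by ring] at this

/-- Polynomials on a triangle are bounded pointwise by their `L²` norm, as are, with a further
inverse power of the diameter, their derivatives. -/
theorem exists_pointwise_bound (k : ℕ) :
    ∃ C : ℝ, 0 < C ∧ ∀ p : MvPolynomial (Fin 2) ℝ, p.totalDegree ≤ k →
      ∀ a b c : Pt, cross (b - a) (c - a) ≠ 0 → ∀ x ∈ hull {a, b, c},
      |cross (b - a) (c - a)| * evalPoly p x ^ 2 ≤
        C * ∫ x in interior (hull {a, b, c}), evalPoly p x ^ 2 ∧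
      ∀ i, |cross (b - a) (c - a)| ^ 3 * evalPoly (MvPolynomial.pderiv i p) x ^ 2 ≤
        C * (‖b - a‖ ^ 2 + ‖c - a‖ ^ 2) *
          ∫ x in interior (hull {a, b, c}), evalPoly p x ^ 2 := by
  obtain ⟨C, hC, h⟩ := exists_ref_bound k
  refine ⟨2 * C, by linarith, fun p hp a b c habc x hx => ?_⟩
  rw [hull_triple] at hx
  obtain ⟨y, hy, rfl⟩ := hx
  set q := MvPolynomial.bind₁ (chartPoly a b c) p
  obtain ⟨h1, h2⟩ := h q (totalDegree_bind₁_le (totalDegree_chartPoly_le a b c) hp) y hy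
  have h3 := integral_refSquare_le habc (g := fun x => evalPoly p x ^ 2)
    ((continuous_evalPoly p).pow 2) (fun _ => sq_nonneg _)
  simp only [q, evalPoly_bind₁_chartPoly] at h1 h2
  set I := ∫ x in refSquare, evalPoly p (chart a b c x) ^ 2
  set J := ∫ x in interior (hull {a, b, c}), evalPoly p x ^ 2
  set D := cross (b - a) (c - a)
  have hD : 0 < |D| := abs_pos.2 habc
  have hI : 0 ≤ I := integral_nonneg fun _ => sq_nonneg _
  constructor
  · calc |D| * evalPoly p (chart a b c y) ^ 2 ≤ |D| * (C * I) := by gcongr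
      _ = C * (|D| * I) := by ring
      _ ≤ C * J := by gcongr
      _ ≤ 2 * C * J := by nlinarith
  · obtain ⟨e0, e1⟩ := evalPoly_pderiv_bind₁_chartPoly a b c p y
    have g0 := h2 0
    have g1 := h2 1
    rw [e0] at g0
    rw [e1] at g1
    simp only [Fin.sum_univ_two] at g0 g1
    -- Of the three powers of $|D|$, two come from Cramer's rule and one from the change of
    -- variables in the integral.
    have main : ∀ Q : ℝ, D ^ 2 * Q ≤ (‖b - a‖ ^ 2 + ‖c - a‖ ^ 2) * (2 * (C * I)) →
        |D| ^ 3 * Q ≤ 2 * C * (‖b - a‖ ^ 2 + ‖c - a‖ ^ 2) * J := by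
      intro Q hQ
      rw [← sq_abs] at hQ
      calc |D| ^ 3 * Q = |D| * (|D| ^ 2 * Q) := by ring
        _ ≤ |D| * ((‖b - a‖ ^ 2 + ‖c - a‖ ^ 2) * (2 * (C * I))) := by gcongr
        _ = 2 * C * (‖b - a‖ ^ 2 + ‖c - a‖ ^ 2) * (|D| * I) := by ring
        _ ≤ _ := by gcongr
    obtain ⟨k0, k1⟩ := cramer_bound (D := D) rfl g0 g1
    rw [← normSq_eq, ← normSq_eq] at k0 k1
    intro i
    fin_cases i
    · exact main _ k0
    · exact main _ k1

/-! ### Shape regularity -/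

theorem volume_hull_ne_top (K : Finset Pt) : (volume : Measure Pt) (hull K) ≠ ⊤ :=
  (isCompact_hull K).measure_lt_top.ne

theorem subset_hull (K : Finset Pt) : (K : Set Pt) ⊆ hull K := subset_convexHull ℝ _

theorem area_nonneg (K : Finset Pt) : 0 ≤ area K := measureReal_nonneg

theorem refArea_pos : 0 < (volume : Measure Pt).real refTriangle :=
  ENNReal.toReal_pos (((isOpen_refSquare.measure_pos volume refSquare_nonempty).trans_le
    (measure_mono refSquare_subset)).ne') isCompact_refTriangle.measure_lt_top.ne

theorem IsTriangle.interior_nonempty {K : Finset Pt} (hK : IsTriangle K) :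
    (interior (hull K)).Nonempty := by
  rw [hull, interior_convexHull_nonempty_iff_affineSpan_eq_top]
  have h := hK.2.affineSpan_eq_top_iff_card_eq_finrank_add_one
  have hr : range (fun z : K => (z : Pt)) = (K : Set Pt) := by ext; simp
  rw [hr] at h
  exact h.2 (by simp [hK.1])

theorem area_pos_of_interior_nonempty {K : Finset Pt} (h : (interior (hull K)).Nonempty) :
    0 < area K :=
  ENNReal.toReal_pos ((isOpen_interior.measure_pos volume h).trans_le
    (measure_mono interior_subset)).ne' (volume_hull_ne_top K)

/-- Both directions pass through the interior: an affinely independent triple has nonempty interior,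
hence positive area and determinant nonzero. Conversely, a nonzero determinant gives an open subset,
hence full affine span. -/
theorem isTriangle_triple_iff {a b c : Pt} :
    IsTriangle {a, b, c} ↔ cross (b - a) (c - a) ≠ 0 := by
  constructor
  · intro h h0
    have := area_pos_of_interior_nonempty h.interior_nonempty
    rw [area_triple, h0] at this
    simp at this
  · intro h
    have hcard : ({a, b, c} : Finset Pt).card = 3 := by
      rw [Finset.card_eq_three]
      refine ⟨a, b, c, ?_, ?_, ?_, rfl⟩ <;> rintro rfl <;> refine h ?_ <;>
        simp [cross, mul_comm]
    refine ⟨hcard, ?_⟩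
    rw [affineIndependent_iff_finrank_vectorSpan_eq ℝ _ (n := 2) (by simp [hcard])]
    have hr : range (fun z : ({a, b, c} : Finset Pt) => (z : Pt)) =
      (({a, b, c} : Finset Pt) : Set Pt) := by ext; simp
    have h2 := interior_hull_nonempty h
    rw [hull, interior_convexHull_nonempty_iff_affineSpan_eq_top] at h2
    rw [hr, ← direction_affineSpan, h2, AffineSubspace.direction_top, finrank_top]
    simp

theorem IsTriangle.exists_eq {K : Finset Pt} (hK : IsTriangle K) :
    ∃ a b c, K = {a, b, c} ∧ cross (b - a) (c - a) ≠ 0 := by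
  obtain ⟨a, b, c, -, -, -, rfl⟩ := Finset.card_eq_three.1 hK.1
  exact ⟨a, b, c, rfl, isTriangle_triple_iff.1 hK⟩

/-- Shape regularity of one triangle. -/
def IsRegular (C : ℝ) (K : Finset Pt) : Prop := ∀ x ∈ K, ∀ y ∈ K, ‖x - y‖ ^ 2 ≤ C * area K

/-- An inscribed ball of radius $r$ has area $\pi r^2\le|K|$, so $\rho_K^2\le4|K|/\pi$, and
$h_K\le\gamma\rho_K$ bounds all sides. -/
theorem IsTriangle.isRegular {K : Finset Pt} (hK : IsTriangle K) {γ : ℝ}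
    (hγ : diamK K / inDiam K ≤ γ) : IsRegular (4 * γ ^ 2 / Real.pi) K := by
  set S := {r : ℝ | 0 ≤ r ∧ ∃ c : Pt, Metric.closedBall c r ⊆ hull K}
  have hS : ∀ r ∈ S, r ≤ Real.sqrt (area K / Real.pi) := by
    rintro r ⟨hr, c, hc⟩
    apply Real.le_sqrt_of_sq_le
    rw [le_div_iff₀ Real.pi_pos]
    have h1 := measureReal_mono hc (μ := volume) (volume_hull_ne_top K)
    rw [Measure.real, EuclideanSpace.volume_closedBall_fin_two] at h1
    simpa [hr, ENNReal.toReal_ofReal Real.pi_pos.le, mul_comm, area] using h1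
  have hbdd : BddAbove S := ⟨_, hS⟩
  -- A ball of positive radius makes `inDiam K` positive. With a zero denominator the quotient would
  -- be zero by convention and `hγ` would say nothing about the diameter.
  obtain ⟨x, hx⟩ := hK.interior_nonempty
  obtain ⟨r, hr, hball⟩ := Metric.nhds_basis_closedBall.mem_iff.1 (mem_interior_iff_mem_nhds.1 hx)
  have hrS : r ∈ S := ⟨hr.le, x, hball⟩
  have hpos : 0 < sSup S := hr.trans_le (le_csSup hbdd hrS)
  have hle : sSup S ≤ Real.sqrt (area K / Real.pi) := csSup_le ⟨r, hrS⟩ hS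
  have hin : inDiam K = 2 * sSup S := rfl
  have hsq : sSup S ^ 2 ≤ area K / Real.pi := by
    rw [← Real.sq_sqrt (div_nonneg (area_nonneg K) Real.pi_pos.le)]
    gcongr
  rw [div_le_iff₀ (by rw [hin]; linarith), hin] at hγ
  intro y hy z hz
  have hd : ‖y - z‖ ≤ diamK K := by
    rw [← dist_eq_norm]
    exact Metric.dist_le_diam_of_mem (isCompact_hull K).isBounded (subset_hull K hy)
      (subset_hull K hz)
  calc ‖y - z‖ ^ 2 ≤ (γ * (2 * sSup S)) ^ 2 := by gcongr; exact hd.trans hγ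
    _ = 4 * γ ^ 2 * sSup S ^ 2 := by ring
    _ ≤ 4 * γ ^ 2 * (area K / Real.pi) := by gcongr
    _ = 4 * γ ^ 2 / Real.pi * area K := by ring

theorem diam_div_inDiam_le_shapeRegularity {T : Finset (Finset Pt)} {K : Finset Pt} (hK : K ∈ T) :
    diamK K / inDiam K ≤ shapeRegularity T :=
  le_csSup (T.finite_toSet.image _).bddAbove (mem_image_of_mem _ hK)

/-! ### Newest vertex bisection -/

/-- The mesh `T'` subdivides the mesh `T`. -/
def Subdivides (T T' : Finset (Finset Pt)) : Prop :=
  (∀ K' ∈ T', ∃ K ∈ T, hull K' ⊆ hull K) ∧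
    ∀ K ∈ T, ∀ x ∈ hull K, ∃ K' ∈ T', hull K' ⊆ hull K ∧ x ∈ hull K'

theorem Subdivides.refl (T : Finset (Finset Pt)) : Subdivides T T :=
  ⟨fun K hK => ⟨K, hK, Subset.rfl⟩, fun K hK _ hx => ⟨K, hK, Subset.rfl, hx⟩⟩

theorem Subdivides.trans {T₁ T₂ T₃ : Finset (Finset Pt)} (h₁ : Subdivides T₁ T₂)
    (h₂ : Subdivides T₂ T₃) : Subdivides T₁ T₃ := by
  constructor
  · intro K hK
    obtain ⟨K', hK', h⟩ := h₂.1 K hK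
    obtain ⟨K'', hK'', h'⟩ := h₁.1 K' hK'
    exact ⟨K'', hK'', h.trans h'⟩
  · intro K hK x hx
    obtain ⟨K', hK', h, hx'⟩ := h₁.2 K hK x hx
    obtain ⟨K'', hK'', h', hx''⟩ := h₂.2 K' hK' x hx'
    exact ⟨K'', hK'', h'.trans h, hx''⟩

theorem hull_child_subset (z a b : Pt) : hull {z, a, midpoint ℝ a b} ⊆ hull {z, a, b} := by
  refine convexHull_min ?_ (convex_hull _)
  have h := subset_hull {z, a, b}
  have ha : a ∈ hull {z, a, b} := h (by simp)
  have hb : b ∈ hull {z, a, b} := h (by simp)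
  have hz : z ∈ hull {z, a, b} := h (by simp)
  have hm : midpoint ℝ a b ∈ hull {z, a, b} :=
    (convex_hull {z, a, b}).segment_subset ha hb (midpoint_mem_segment a b)
  intro x hx
  simp only [Finset.coe_insert, Finset.coe_singleton, mem_insert_iff, mem_singleton_iff] at hx
  rcases hx with rfl | rfl | rfl <;> assumption

theorem hull_child_subset' (z a b : Pt) : hull {z, b, midpoint ℝ a b} ⊆ hull {z, a, b} := by
  rw [midpoint_comm, Finset.pair_comm a b]
  exact hull_child_subset z b a

theorem midpoint_eq_half_smul (a b : Pt) : midpoint ℝ a b = (1 / 2 : ℝ) • (a + b) := by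
  rw [midpoint_eq_smul_add]; simp

theorem chart_mem_hull_child {z a b y : Pt} (hy : y ∈ refTriangle) (h : y 1 ≤ y 0) :
    chart z a b y ∈ hull {z, a, midpoint ℝ a b} := by
  obtain ⟨h0, h1, h2⟩ := hy
  rw [hull_triple]
  -- With $m$ the midpoint, $b-z=2(m-z)-(a-z)$; substitution gives these coordinates with respect to
  -- $a-z$ and $m-z$.
  refine ⟨!₂[y 0 - y 1, 2 * y 1], ⟨?_, ?_, ?_⟩, ?_⟩
  · simpa using h
  · simpa using h1
  · simp; linarith
  · rw [chart_apply, chart_apply, midpoint_eq_half_smul]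
    ext i
    simp
    ring

theorem chart_swap (z a b y : Pt) : chart z a b y = chart z b a !₂[y 1, y 0] := by
  rw [chart_apply, chart_apply]; ext i; simp; ring

theorem hull_subset_children (z a b : Pt) :
    hull {z, a, b} ⊆ hull {z, a, midpoint ℝ a b} ∪ hull {z, b, midpoint ℝ a b} := by
  rw [hull_triple]
  rintro _ ⟨y, hy, rfl⟩
  rcases le_total (y 1) (y 0) with h | h
  · exact Or.inl (chart_mem_hull_child hy h)
  · right
    rw [chart_swap, midpoint_comm]
    obtain ⟨h0, h1, h2⟩ := hy
    exact chart_mem_hull_child ⟨by simpa using h1, by simpa using h0, by simp; linarith⟩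
      (by simpa using h)

theorem Bisection.subdivides {M M' : MarkedMesh} (h : Bisection M M') :
    Subdivides M.elements M'.elements := by
  obtain ⟨z, a, b, hmem, -, hel, -⟩ := h
  have hel' : ∀ K, K ∈ M'.elements ↔ (K ≠ {z, a, b} ∧ K ∈ M.elements) ∨
      K = {z, a, midpoint ℝ a b} ∨ K = {z, b, midpoint ℝ a b} := by
    intro K; rw [hel]; simp; tauto
  constructor
  · intro K' hK'
    rcases (hel' K').1 hK' with ⟨-, h⟩ | rfl | rfl
    · exact ⟨K', h, Subset.rfl⟩
    · exact ⟨_, hmem, hull_child_subset z a b⟩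
    · exact ⟨_, hmem, hull_child_subset' z a b⟩
  · intro K hK x hx
    by_cases hKe : K = {z, a, b}
    · subst hKe
      rcases hull_subset_children z a b hx with h | h
      · exact ⟨_, (hel' _).2 (Or.inr (Or.inl rfl)), hull_child_subset z a b, h⟩
      · exact ⟨_, (hel' _).2 (Or.inr (Or.inr rfl)), hull_child_subset' z a b, h⟩
    · exact ⟨K, (hel' _).2 (Or.inl ⟨hKe, hK⟩), Subset.rfl, hx⟩

theorem subdivides_of_reflTransGen {M M' : MarkedMesh}
    (h : Relation.ReflTransGen Bisection M M') : Subdivides M.elements M'.elements := by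
  induction h with
  | refl => exact Subdivides.refl _
  | tail _ h ih => exact ih.trans h.subdivides

/-- In suitable affine coordinates, all descendants of a triangle under newest vertex bisection are
right isosceles triangles with the right angle at the newest vertex. -/
def IsSkewIsosceles (C : ℝ) (z : Pt) (K : Finset Pt) : Prop :=
  ∃ (u w : Pt) (p r : ℝ), cross u w ≠ 0 ∧ ‖u‖ ^ 2 + ‖w‖ ^ 2 ≤ C * |cross u w| ∧
    p ^ 2 + r ^ 2 ≠ 0 ∧ K = {z, z + (p • u + r • w), z + (-r • u + p • w)}

theorem cross_skew (u w : Pt) (p r : ℝ) :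
    cross (p • u + r • w) (-r • u + p • w) = (p ^ 2 + r ^ 2) * cross u w := by
  simp [cross]; ring

theorem norm_skew_sq_le (u w : Pt) (p r : ℝ) :
    ‖p • u + r • w‖ ^ 2 ≤ (p ^ 2 + r ^ 2) * (‖u‖ ^ 2 + ‖w‖ ^ 2) := by
  rw [normSq_eq, normSq_eq, normSq_eq]
  simp
  nlinarith [sq_nonneg (p * w 0 - r * u 0), sq_nonneg (p * w 1 - r * u 1)]

theorem IsSkewIsosceles.isTriangle {C : ℝ} {z : Pt} {K : Finset Pt} (h : IsSkewIsosceles C z K) :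
    IsTriangle K := by
  obtain ⟨u, w, p, r, h0, -, hpr, rfl⟩ := h
  rw [isTriangle_triple_iff, add_sub_cancel_left, add_sub_cancel_left, cross_skew]
  exact mul_ne_zero hpr h0

/-- The squared sides and the area both scale with $p^2+r^2$, which cancels. The constant thus does
not depend on the number of bisections. The factor 4 accounts for the hypotenuse. -/
theorem IsSkewIsosceles.isRegular {C : ℝ} {z : Pt} {K : Finset Pt} (h : IsSkewIsosceles C z K) :
    IsRegular (4 * C / (volume : Measure Pt).real refTriangle) K := by
  obtain ⟨u, w, p, r, h0, hC, hpr, rfl⟩ := h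
  have hV := refArea_pos
  have h1 := norm_skew_sq_le u w p r
  have h2 := norm_skew_sq_le u w (-r) p
  have h3 : p ^ 2 + r ^ 2 = (-r) ^ 2 + p ^ 2 := by ring
  rw [← h3] at h2
  set N := (p ^ 2 + r ^ 2) * (‖u‖ ^ 2 + ‖w‖ ^ 2)
  set A := p • u + r • w
  set B := -r • u + p • w
  have hN : 0 ≤ N := (sq_nonneg _).trans h1
  have hAB : ‖A - B‖ ^ 2 ≤ 4 * N := by
    have := norm_sub_le A B
    nlinarith [norm_nonneg (A - B), norm_nonneg A, norm_nonneg B, sq_nonneg (‖A‖ - ‖B‖)]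
  have key : 4 * N ≤ 4 * C / (volume : Measure Pt).real refTriangle * area {z, z + A, z + B} := by
    rw [area_triple, add_sub_cancel_left, add_sub_cancel_left, cross_skew, abs_mul,
      abs_of_nonneg (by positivity : (0:ℝ) ≤ p ^ 2 + r ^ 2)]
    have : (p ^ 2 + r ^ 2) * (‖u‖ ^ 2 + ‖w‖ ^ 2) ≤ (p ^ 2 + r ^ 2) * (C * |cross u w|) := by gcongr
    field_simp
    simp only [N]
    linarith
  intro x hx y hy
  refine le_trans ?_ key
  simp only [Finset.mem_insert, Finset.mem_singleton] at hx hy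
  rcases hx with rfl | rfl | rfl <;> rcases hy with rfl | rfl | rfl <;>
    simp [norm_sub_rev B A] <;> linarith

theorem midpoint_skew (z u w : Pt) (p r : ℝ) :
    midpoint ℝ (z + (p • u + r • w)) (z + (-r • u + p • w)) =
      z + (((p - r) / 2) • u + ((p + r) / 2) • w) := by
  rw [midpoint_eq_half_smul]; ext i; simp; ring

/-- With $\zeta=p+ir$ in the coordinates `u`, `w`, the sides at $z$ are $\zeta$ and $i\zeta$, and
the midpoint is $m=z+\frac{1+i}2\zeta$. Then $z-m=-\frac{1+i}2\zeta$ and $a-m=i(z-m)$, while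
$b-m=\frac{i-1}2\zeta$ and $z-m=i(b-m)$. So each child has two sides at $m$ that differ by a factor
$i$; the axes `u`, `w` are unchanged. -/
theorem isSkewIsosceles_children {C : ℝ} {z u w : Pt} {p r : ℝ} (h0 : cross u w ≠ 0)
    (hC : ‖u‖ ^ 2 + ‖w‖ ^ 2 ≤ C * |cross u w|) (hpr : p ^ 2 + r ^ 2 ≠ 0) {a b : Pt}
    (ha : a = z + (p • u + r • w)) (hb : b = z + (-r • u + p • w)) :
    IsSkewIsosceles C (midpoint ℝ a b) {z, a, midpoint ℝ a b} ∧
      IsSkewIsosceles C (midpoint ℝ a b) {z, b, midpoint ℝ a b} := by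
  rw [ha, hb, midpoint_skew]
  set m := z + (((p - r) / 2) • u + ((p + r) / 2) • w) with hm
  constructor
  · refine ⟨u, w, -((p - r) / 2), -((p + r) / 2), h0, hC, ?_, ?_⟩
    · contrapose! hpr; linarith
    · have e1 : m + (-((p - r) / 2) • u + -((p + r) / 2) • w) = z := by
        rw [hm]; ext i; simp; ring
      have e2 : m + (- -((p + r) / 2) • u + -((p - r) / 2) • w) = z + (p • u + r • w) := by
        rw [hm]; ext i; simp; ring
      rw [e1, e2]; ext x; simp; tauto
  · refine ⟨u, w, -((p + r) / 2), (p - r) / 2, h0, hC, ?_, ?_⟩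
    · contrapose! hpr; linarith
    · have e1 : m + (-((p + r) / 2) • u + ((p - r) / 2) • w) = z + (-r • u + p • w) := by
        rw [hm]; ext i; simp; ring
      have e2 : m + (-((p - r) / 2) • u + -((p + r) / 2) • w) = z := by
        rw [hm]; ext i; simp; ring
      rw [e1, e2]; ext x; simp; tauto

theorem pair_eq_of_triple_eq {z a b a' b' : Pt} (hc : ({z, a, b} : Finset Pt).card = 3)
    (h : ({z, a, b} : Finset Pt) = {z, a', b'}) : (a = a' ∧ b = b') ∨ (a = b' ∧ b = a') := by
  have hz : z ∉ ({a, b} : Finset Pt) := fun hz => by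
    have h3 := Finset.card_le_two (a := a) (b := b)
    rw [Finset.insert_eq_of_mem hz] at hc; omega
  have hz' : z ∉ ({a', b'} : Finset Pt) := fun hz => by
    have h3 := Finset.card_le_two (a := a') (b := b')
    rw [h, Finset.insert_eq_of_mem hz] at hc; omega
  have h2 : ({a, b} : Finset Pt) = {a', b'} := by
    rw [← Finset.erase_insert hz, ← Finset.erase_insert hz', h]
  have h3 : ({a, b} : Set Pt) = {a', b'} := by
    have := congrArg (fun s : Finset Pt => (s : Set Pt)) h2
    simpa using this
  exact Set.pair_eq_pair_iff.1 h3

/-- All triangles of the mesh are skew isosceles with respect to their marked vertex. -/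
def MarkedMesh.IsSkew (C : ℝ) (M : MarkedMesh) : Prop :=
  ∀ K ∈ M.elements, IsSkewIsosceles C (M.newest K) K

theorem Bisection.isSkew {C : ℝ} {M M' : MarkedMesh} (h : Bisection M M') (hM : M.IsSkew C) :
    M'.IsSkew C := by
  obtain ⟨z, a, b, hmem, hz, hel, hnew⟩ := h
  have hchild : IsSkewIsosceles C (midpoint ℝ a b) {z, a, midpoint ℝ a b} ∧
      IsSkewIsosceles C (midpoint ℝ a b) {z, b, midpoint ℝ a b} := by
    have hK := hM _ hmem
    have hcard := hK.isTriangle.1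
    obtain ⟨u, w, p, r, h0, hC, hpr, he⟩ := hK
    rw [hz] at he
    rcases pair_eq_of_triple_eq hcard he with ⟨ha, hb⟩ | ⟨ha, hb⟩
    · exact isSkewIsosceles_children h0 hC hpr ha hb
    · rw [midpoint_comm]
      exact (isSkewIsosceles_children h0 hC hpr hb ha).symm
  intro K hK
  have hnewK := congrFun hnew K
  -- The cases follow the updates of the marking, outermost first. A triangle equal to neither child
  -- is an old one with its old mark.
  by_cases h2 : K = {z, b, midpoint ℝ a b}
  · rw [hnewK, h2, Function.update_self]; exact hchild.2
  · rw [Function.update_of_ne h2] at hnewK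
    by_cases h1 : K = {z, a, midpoint ℝ a b}
    · rw [hnewK, h1, Function.update_self]; exact hchild.1
    · rw [hnewK, Function.update_of_ne h1]
      refine hM K ?_
      rw [hel] at hK
      simp only [Finset.mem_union, Finset.mem_erase, Finset.mem_insert, Finset.mem_singleton] at hK
      tauto

theorem isSkew_of_reflTransGen {C : ℝ} {M M' : MarkedMesh}
    (h : Relation.ReflTransGen Bisection M M') (hM : M.IsSkew C) : M'.IsSkew C := by
  induction h with
  | refl => exact hM
  | tail _ h ih => exact h.isSkew ih

/-- The sides at the marked vertex serve as the coordinate axes, with `p = 1` and `r = 0`. Shape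
regularity bounds both squared lengths by the area, that is, by the determinant times the reference
area. -/
theorem isSkew_of_isTriangulation {Ω : Set Pt} {M : MarkedMesh}
    (hT : IsTriangulation Ω M.elements) (hM : M.IsMarking) {γ : ℝ}
    (hγ : shapeRegularity M.elements ≤ γ) :
    M.IsSkew (2 * (4 * γ ^ 2 / Real.pi) * (volume : Measure Pt).real refTriangle) := by
  intro K hK
  have htri := hT.isTriangle K hK
  have hreg := htri.isRegular ((diam_div_inDiam_le_shapeRegularity hK).trans hγ)
  have hz := hM K hK
  obtain ⟨a, b, hab⟩ : ∃ a b, K = {M.newest K, a, b} := by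
    obtain ⟨a, b, -, h⟩ := Finset.card_eq_two.1
      (show (K.erase (M.newest K)).card = 2 by rw [Finset.card_erase_of_mem hz, htri.1])
    exact ⟨a, b, by rw [← h, Finset.insert_erase hz]⟩
  generalize M.newest K = z at *
  subst hab
  refine ⟨a - z, b - z, 1, 0, isTriangle_triple_iff.1 htri, ?_, by norm_num, by simp⟩
  have h1 := hreg a (by simp) z (by simp)
  have h2 := hreg b (by simp) z (by simp)
  rw [area_triple] at h1 h2
  linarith

/-! ### Conforming meshes -/

theorem IsTriangle.hull_inter {K F G : Finset Pt} (hK : IsTriangle K) (hF : F ⊆ K) (hG : G ⊆ K) :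
    hull F ∩ hull G = hull (F ∩ G) := by
  rw [hull, hull, hull, Finset.coe_inter]
  exact (AffineIndependent.convexHull_inter hK.2 hF hG).symm

theorem IsTriangle.mem_of_mem_hull {K F : Finset Pt} (hK : IsTriangle K) (hF : F ⊆ K) {x : Pt}
    (hx : x ∈ K) (hxF : x ∈ hull F) : x ∈ F := by
  have h1 : x ∈ hull {x} ∩ hull F := ⟨subset_hull _ (by simp), hxF⟩
  rw [hK.hull_inter (by simpa using hx) hF] at h1
  by_contra hn
  rw [Finset.singleton_inter_of_notMem hn] at h1
  simp [hull] at h1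

/-- The midpoint is in the relative interior of the edge, so a face containing it contains the edge:
otherwise at most one endpoint would be left in the intersection, and the midpoint would equal it.
-/
theorem IsTriangle.subset_of_midpoint_mem {K F : Finset Pt} (hK : IsTriangle K) (hF : F ⊆ K)
    {p q : Pt} (hp : p ∈ K) (hq : q ∈ K) (hpq : p ≠ q) (hm : midpoint ℝ p q ∈ hull F) :
    p ∈ F ∧ q ∈ F := by
  have hE : ({p, q} : Finset Pt) ⊆ K := by
    intro x hx; simp at hx; rcases hx with rfl | rfl <;> assumption
  have h1 : midpoint ℝ p q ∈ hull {p, q} ∩ hull F := by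
    refine ⟨?_, hm⟩
    rw [hull, Finset.coe_pair, convexHull_pair]
    exact midpoint_mem_segment p q
  rw [hK.hull_inter hE hF] at h1
  have key : ∀ y ∈ ({p, q} : Finset Pt), y ∉ F → midpoint ℝ p q ≠ y →
      ∀ z, ({p, q} : Finset Pt) = {y, z} → midpoint ℝ p q = z := by
    intro y _ hyF _ z hz
    have h2 : ({p, q} : Finset Pt) ∩ F ⊆ {z} := by
      intro t ht
      rw [hz] at ht
      simp only [Finset.mem_inter, Finset.mem_insert, Finset.mem_singleton] at ht ⊢
      rcases ht with ⟨rfl | h, h'⟩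
      · exact absurd h' hyF
      · exact h
    have h3 : midpoint ℝ p q ∈ hull {z} := convexHull_mono (Finset.coe_subset.2 h2) h1
    simpa [hull] using h3
  constructor
  · by_contra h
    exact hpq ((midpoint_eq_right_iff ℝ).1
      (key p (by simp) h (fun h' => hpq ((midpoint_eq_left_iff ℝ).1 h')) q rfl))
  · by_contra h
    exact hpq ((midpoint_eq_left_iff ℝ).1
      (key q (by simp) h (fun h' => hpq ((midpoint_eq_right_iff ℝ).1 h')) p (Finset.pair_comm p q)))

/-- By conformity, `hull K` is spanned by the common vertices; since no vertex of a triangle lies in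
the hull of the others, all vertices of `K` are common. -/
theorem eq_of_hull_subset {T : Finset (Finset Pt)} (hT : IsConforming T)
    (htri : ∀ K ∈ T, IsTriangle K) {K K' : Finset Pt} (hK : K ∈ T) (hK' : K' ∈ T)
    (h : hull K ⊆ hull K') : K = K' := by
  have h1 := hT K hK K' hK'
  rw [inter_eq_self_of_subset_left h] at h1
  refine Finset.eq_of_subset_of_card_le (fun x hx => ?_)
    (by rw [(htri K hK).1, (htri K' hK').1])
  have h2 : x ∈ hull (K ∩ K') := h1 ▸ subset_hull K hx
  exact (Finset.mem_inter.1
    ((htri K hK).mem_of_mem_hull Finset.inter_subset_left hx h2)).2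

theorem interior_hull_pair (b c : Pt) : interior (hull {b, c}) = ∅ := by
  by_contra h
  have h1 := area_pos_of_interior_nonempty (nonempty_iff_ne_empty.2 h)
  have h2 : ({b, c} : Finset Pt) = {b, c, c} := by ext; simp
  rw [h2, area_triple, cross_self] at h1
  simp at h1

/-- Two different triangles share at most two vertices, so they meet within a segment, which has
empty interior. -/
theorem disjoint_interior_hull {T : Finset (Finset Pt)} (hT : IsConforming T)
    (htri : ∀ K ∈ T, IsTriangle K) {K K' : Finset Pt} (hK : K ∈ T) (hK' : K' ∈ T) (h : K ≠ K') :
    Disjoint (interior (hull K)) (interior (hull K')) := by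
  rw [Set.disjoint_iff_inter_eq_empty, ← interior_inter, hT K hK K' hK']
  have hne : K ∩ K' ≠ K := fun he => h (Finset.eq_of_subset_of_card_le
    (Finset.inter_eq_left.1 he) (by rw [(htri K hK).1, (htri K' hK').1]))
  obtain ⟨x, hx, hxn⟩ := Finset.exists_of_ssubset
    (Finset.ssubset_iff_subset_ne.2 ⟨Finset.inter_subset_left, hne⟩)
  obtain ⟨b, c, -, hbc⟩ := Finset.card_eq_two.1
    (show (K.erase x).card = 2 by rw [Finset.card_erase_of_mem hx, (htri K hK).1])
  have hsub : K ∩ K' ⊆ {b, c} := by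
    rw [← hbc]
    exact fun y hy => Finset.mem_erase.2 ⟨fun e => hxn (e ▸ hy), (Finset.mem_inter.1 hy).1⟩
  have h1 : hull (K ∩ K') ⊆ hull {b, c} := convexHull_mono (Finset.coe_subset.2 hsub)
  have h2 := interior_mono h1
  rw [interior_hull_pair] at h2
  exact subset_empty_iff.1 h2

/-- The triangles across the edge `E` of `K`. -/
def opposite (T : Finset (Finset Pt)) (K E : Finset Pt) : Finset (Finset Pt) :=
  {K' ∈ T | E ⊆ K' ∧ K' ≠ K}

theorem mem_opposite {T : Finset (Finset Pt)} {K E K' : Finset Pt} :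
    K' ∈ opposite T K E ↔ K' ∈ T ∧ E ⊆ K' ∧ K' ≠ K := by simp [opposite]

/-- The coarse triangle containing `K₂'` contains the vertices of `E`, and conformity with `K` makes
them vertices of it. It is not `K`, as `K` is itself a triangle of the fine mesh and contains no
other one. -/
theorem exists_opposite_of_subdivides {T T' : Finset (Finset Pt)} (hT : IsConforming T)
    (hT' : IsConforming T') (htri : ∀ K ∈ T, IsTriangle K) (htri' : ∀ K ∈ T', IsTriangle K)
    (hsub : Subdivides T T') {K E : Finset Pt} (hK : K ∈ T) (hK' : K ∈ T') (hE : E ⊆ K)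
    {K₂' : Finset Pt} (h : K₂' ∈ opposite T' K E) :
    ∃ K₂ ∈ opposite T K E, hull K₂' ⊆ hull K₂ := by
  obtain ⟨h1, h2, h3⟩ := mem_opposite.1 h
  obtain ⟨K₂, hK₂, hle⟩ := hsub.1 K₂' h1
  refine ⟨K₂, mem_opposite.2 ⟨hK₂, fun x hx => ?_, ?_⟩, hle⟩
  · have hx1 : x ∈ hull K ∩ hull K₂ :=
      ⟨subset_hull _ (hE hx), hle (subset_hull _ (h2 hx))⟩
    rw [hT K hK K₂ hK₂] at hx1
    exact (Finset.mem_inter.1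
      ((htri K hK).mem_of_mem_hull Finset.inter_subset_left (hE hx) hx1)).2
  · rintro rfl
    exact h3 (eq_of_hull_subset hT' htri' h1 hK' hle)

/-- A fine triangle inside the coarse neighbour contains the midpoint of `E`. Since `K` also belongs
to the conforming fine mesh, their common face contains this midpoint and hence all of `E`; there is
no hanging node. -/
theorem opposite_nonempty_of_subdivides {T T' : Finset (Finset Pt)} (hT : IsConforming T)
    (hT' : IsConforming T') (htri : ∀ K ∈ T, IsTriangle K)
    (hsub : Subdivides T T') {K E : Finset Pt} (hK : K ∈ T) (hK' : K ∈ T') (hE : E ∈ edgesOf K)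
    (h : (opposite T K E).Nonempty) : (opposite T' K E).Nonempty := by
  obtain ⟨K₂, hK₂⟩ := h
  obtain ⟨h1, h2, h3⟩ := mem_opposite.1 hK₂
  obtain ⟨hEK, hcard⟩ := Finset.mem_powersetCard.1 hE
  obtain ⟨p, q, hpq, rfl⟩ := Finset.card_eq_two.1 hcard
  have hmid : ∀ S : Finset Pt, {p, q} ⊆ S → midpoint ℝ p q ∈ hull S := fun S hS =>
    (convex_hull S).segment_subset (subset_hull S (hS (by simp))) (subset_hull S (hS (by simp)))
      (midpoint_mem_segment p q)
  obtain ⟨K₂', hK₂', hle, hm⟩ := hsub.2 K₂ h1 _ (hmid K₂ h2)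
  have hm2 : midpoint ℝ p q ∈ hull K ∩ hull K₂' := ⟨hmid K hEK, hm⟩
  rw [hT' K hK' K₂' hK₂'] at hm2
  obtain ⟨hp, hq⟩ := (htri K hK).subset_of_midpoint_mem Finset.inter_subset_left
    (hEK (by simp)) (hEK (by simp)) hpq hm2
  refine ⟨K₂', mem_opposite.2 ⟨hK₂', ?_, ?_⟩⟩
  · intro x hx
    simp only [Finset.mem_insert, Finset.mem_singleton] at hx
    rcases hx with rfl | rfl
    · exact (Finset.mem_inter.1 hp).2
    · exact (Finset.mem_inter.1 hq).2
  · rintro rfl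
    exact h3 (eq_of_hull_subset hT htri hK h1 hle).symm

/-! ### Sides of an edge -/

theorem cross_add_right (u v w : Pt) : cross u (v + w) = cross u v + cross u w := by
  simp [cross]; ring

theorem cross_smul_right (r : ℝ) (u w : Pt) : cross u (r • w) = r * cross u w := by
  simp [cross]; ring

/-- Near the midpoint of their common side, two triangles on the same side of it overlap off the
line through `p` and `q`. If `c ≠ c'`, conformity would confine the intersection to this line. -/
theorem eq_of_same_side {T : Finset (Finset Pt)} (hT : IsConforming T) {p q c c' : Pt}
    (h : {p, q, c} ∈ T) (h' : {p, q, c'} ∈ T)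
    (hs : 0 < cross (q - p) (c - p) * cross (q - p) (c' - p)) :
    ({p, q, c} : Finset Pt) = {p, q, c'} := by
  have hc : cross (q - p) (c - p) ≠ 0 := left_ne_zero_of_mul hs.ne'
  by_cases hcc : c = c'
  · rw [hcc]
  exfalso
  obtain ⟨y, hy⟩ := (coordMap_bijective hc).2 (c' - p)
  rw [coordMap_apply] at hy
  set α := y 0
  set β := y 1
  have hβ : cross (q - p) (c' - p) = β * cross (q - p) (c - p) := by
    rw [← hy, cross_add_right, cross_smul_right, cross_smul_right, cross_self]; ring
  have hβ0 : 0 < β := by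
    rw [hβ] at hs
    have h2 : 0 < β * (cross (q - p) (c - p)) ^ 2 := by linarith
    exact pos_of_mul_pos_left h2 (sq_nonneg _)
  -- With $c'-p=\alpha(q-p)+\beta(c-p)$, the point $\frac12(p+q)+t(c'-p)$ has coordinates
  -- $(\frac12+t\alpha,t\beta)$ in the first triangle. This $t$ satisfies
  -- $t(1+|\alpha|+\beta)=\frac12$, which keeps the point in both triangles.
  set t := 1 / (2 * (1 + |α| + β))
  have hden : 0 < 2 * (1 + |α| + β) := by positivity
  have ht : 0 < t := by positivity
  have ht1 : t * (2 * (1 + |α| + β)) = 1 := div_mul_cancel₀ _ hden.ne'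
  have hα1 : t * α ≤ t * |α| := mul_le_mul_of_nonneg_left (le_abs_self α) ht.le
  have hα2 : -(t * |α|) ≤ t * α := by
    have := mul_le_mul_of_nonneg_left (neg_abs_le α) ht.le
    linarith
  have htα : 0 ≤ t * |α| := by positivity
  have htβ : 0 < t * β := by positivity
  have ht2 : t + t * |α| + t * β = 1 / 2 := by linarith
  have hx1 : chart p q c' !₂[1 / 2, t] ∈ hull {p, q, c'} := by
    rw [hull_triple]
    exact mem_image_of_mem _ ⟨by simp, by simpa using ht.le, by simp; linarith⟩
  have hx2 : chart p q c' !₂[1 / 2, t] ∈ hull {p, q, c} := by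
    rw [hull_triple]
    refine ⟨!₂[1 / 2 + t * α, t * β], ⟨?_, ?_, ?_⟩, ?_⟩
    · simp; linarith
    · simpa using htβ.le
    · simp; linarith
    · rw [chart_apply, chart_apply, ← hy]
      ext i; simp; ring
  have hx : chart p q c' !₂[1 / 2, t] ∈ hull {p, q, c} ∩ hull {p, q, c'} := ⟨hx2, hx1⟩
  rw [hT _ h _ h'] at hx
  have hcap : ({p, q, c} : Finset Pt) ∩ {p, q, c'} ⊆ {p, q, q} := by
    intro z hz
    simp only [Finset.mem_inter, Finset.mem_insert, Finset.mem_singleton] at hz ⊢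
    obtain ⟨h1, h2⟩ := hz
    rcases h1 with h1 | h1 | h1
    · exact Or.inl h1
    · exact Or.inr (Or.inl h1)
    · subst h1
      rcases h2 with h2 | h2 | h2
      · exact Or.inl h2
      · exact Or.inr (Or.inl h2)
      · exact absurd h2 hcc
  have hx3 : chart p q c' !₂[1 / 2, t] ∈ hull {p, q, q} :=
    convexHull_mono (Finset.coe_subset.2 hcap) hx
  rw [hull_triple] at hx3
  obtain ⟨s, -, hs2⟩ := hx3
  -- This functional vanishes on the line through `p` and `q`, but not at the chosen point.
  have h3 := congrArg (fun v => cross (q - p) (v - p)) hs2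
  simp only [chart_apply, add_sub_cancel_left, cross_add_right, cross_smul_right, cross_self] at h3
  have h4 : t * cross (q - p) (c' - p) = 0 := by simpa using h3.symm
  exact mul_ne_zero ht.ne' (right_ne_zero_of_mul hs.ne') h4

theorem exists_eq_triple {K E : Finset Pt} {p q : Pt} (hK : IsTriangle K) (hpq : E = {p, q})
    (hcard : E.card = 2) (hE : E ⊆ K) :
    ∃ c, K = {p, q, c} ∧ K \ E = {c} ∧ cross (q - p) (c - p) ≠ 0 := by
  subst hpq
  obtain ⟨c, hc⟩ := Finset.card_eq_one.1
    (show (K \ {p, q}).card = 1 by rw [Finset.card_sdiff_of_subset hE, hK.1, hcard])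
  have h : K = {p, q, c} := by
    rw [← Finset.union_sdiff_of_subset hE, hc]
    ext; simp
  exact ⟨c, h, hc, isTriangle_triple_iff.1 (h ▸ hK)⟩

/-- Both triangles lie on the side of `E` that does not contain `K`, hence on the same side. -/
theorem opposite_subsingleton {T : Finset (Finset Pt)} (hT : IsConforming T)
    (htri : ∀ K ∈ T, IsTriangle K) {K E : Finset Pt} (hK : K ∈ T) (hE : E ∈ edgesOf K)
    {K₁ K₂ : Finset Pt} (h₁ : K₁ ∈ opposite T K E) (h₂ : K₂ ∈ opposite T K E) : K₁ = K₂ := by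
  obtain ⟨hEK, hcard⟩ := Finset.mem_powersetCard.1 hE
  obtain ⟨p, q, hpq, hEeq⟩ := Finset.card_eq_two.1 hcard
  obtain ⟨hT₁, hE₁, hne₁⟩ := mem_opposite.1 h₁
  obtain ⟨hT₂, hE₂, hne₂⟩ := mem_opposite.1 h₂
  obtain ⟨c, rfl, -, hc⟩ := exists_eq_triple (htri K hK) hEeq hcard hEK
  obtain ⟨c₁, rfl, -, hc₁⟩ := exists_eq_triple (htri _ hT₁) hEeq hcard hE₁
  obtain ⟨c₂, rfl, -, hc₂⟩ := exists_eq_triple (htri _ hT₂) hEeq hcard hE₂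
  have k₁ : ¬ 0 < cross (q - p) (c₁ - p) * cross (q - p) (c - p) := fun h => hne₁ (eq_of_same_side hT hT₁ hK h)
  have k₂ : ¬ 0 < cross (q - p) (c₂ - p) * cross (q - p) (c - p) := fun h => hne₂ (eq_of_same_side hT hT₂ hK h)
  refine eq_of_same_side hT hT₁ hT₂ ?_
  have k₁' := lt_of_le_of_ne (not_lt.1 k₁) (mul_ne_zero hc₁ hc)
  have k₂' := lt_of_le_of_ne (not_lt.1 k₂) (mul_ne_zero hc₂ hc)
  have h3 := mul_pos_of_neg_of_neg k₁' k₂'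
  refine pos_of_mul_pos_left (b := cross (q - p) (c - p) ^ 2) ?_ (sq_nonneg _)
  linarith

theorem inner_normal (p : Pt × Pt) (w : Pt) :
    inner ℝ w (normal p) = (dist p.1 p.2)⁻¹ * cross (p.2 - p.1) w := by
  simp [normal, tangent, cross, PiLp.inner_apply]
  ring

theorem isLeftOf_iff {p : Pt × Pt} {E K : Finset Pt} {c : Pt} (hp : p.1 ≠ p.2)
    (hE : E ∈ edgesOf K) (hc : K \ E = {c}) :
    IsLeftOf p E K ↔ cross (p.2 - p.1) (c - p.1) < 0 := by
  have hd : 0 < (dist p.1 p.2)⁻¹ := inv_pos.2 (dist_pos.2 hp)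
  simp only [IsLeftOf, hE, true_and, hc, Finset.mem_singleton, forall_eq, inner_normal]
  constructor
  · intro h; by_contra hn; exact absurd h (not_lt.2 (mul_nonneg hd.le (not_lt.1 hn)))
  · exact fun h => mul_neg_of_pos_of_neg hd h

theorem isRightOf_iff {p : Pt × Pt} {E K : Finset Pt} {c : Pt} (hp : p.1 ≠ p.2)
    (hE : E ∈ edgesOf K) (hc : K \ E = {c}) :
    IsRightOf p E K ↔ 0 < cross (p.2 - p.1) (c - p.1) := by
  have hd : 0 < (dist p.1 p.2)⁻¹ := inv_pos.2 (dist_pos.2 hp)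
  simp only [IsRightOf, hE, true_and, hc, Finset.mem_singleton, forall_eq, inner_normal]
  exact mul_pos_iff_of_pos_left hd

/-- Up to the sign, the jump over an edge is seen from either of the adjacent triangles. -/
theorem jump_eq_or_eq_neg {F : Type*} [NormedAddCommGroup F] {Ω : Set Pt}
    {T : Finset (Finset Pt)} {σ : Finset Pt → Pt × Pt} (hT : IsConforming T)
    (htri : ∀ K ∈ T, IsTriangle K) (hσ : IsNumbering Ω T σ) {K E : Finset Pt} (hK : K ∈ T)
    (hE : E ∈ edgesOf K) (u : Pt → F) (x : Pt) :
    let J := restr K u x - if IsBoundaryEdge Ω E then 0 else ∑ K' ∈ opposite T K E, restr K' u x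
    jump Ω T σ u E x = J ∨ jump Ω T σ u E x = -J := by
  intro J
  obtain ⟨hEK, hcard⟩ := Finset.mem_powersetCard.1 hE
  have hET : E ∈ edges T := Finset.mem_biUnion.2 ⟨K, hK, hE⟩
  have hEeq := hσ.endpoints E hET
  have hout := hσ.outward E hET
  simp only [jump, leftTrace, rightTrace, J]
  generalize σ E = p at *
  have hp : p.1 ≠ p.2 := fun h => by rw [hEeq, h] at hcard; simp at hcard
  obtain ⟨c, hKc, hc, hc0⟩ := exists_eq_triple (htri K hK) hEeq hcard hEK
  have hleft := isLeftOf_iff hp hE hc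
  have hright := isRightOf_iff hp hE hc
  have hsame : ∀ K' ∈ T, ∀ c', K' = {p.1, p.2, c'} →
      0 < cross (p.2 - p.1) (c - p.1) * cross (p.2 - p.1) (c' - p.1) → K = K' := by
    rintro _ hK' c' rfl hs
    rw [hKc]
    exact eq_of_same_side hT (hKc ▸ hK) hK' hs
  have hedge : ∀ K' : Finset Pt, E ⊆ K' → E ∈ edgesOf K' := fun K' h =>
    Finset.mem_powersetCard.2 ⟨h, hcard⟩
  have hsub : ∀ K' : Finset Pt, E ∈ edgesOf K' → E ⊆ K' := fun K' h =>
    (Finset.mem_powersetCard.1 h).1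
  rcases lt_or_gt_of_ne hc0 with hneg | hpos
  · have h1 : ({K' ∈ T | IsLeftOf p E K'} : Finset (Finset Pt)) = {K} := by
      ext K'
      simp only [Finset.mem_filter, Finset.mem_singleton]
      constructor
      · rintro ⟨hK', hl⟩
        obtain ⟨c', e, hc', -⟩ := exists_eq_triple (htri K' hK') hEeq hcard (hsub _ hl.1)
        exact (hsame K' hK' c' e (mul_pos_of_neg_of_neg hneg
          ((isLeftOf_iff hp hl.1 hc').1 hl))).symm
      · rintro rfl; exact ⟨hK, hleft.2 hneg⟩
    have h2 : ({K' ∈ T | IsRightOf p E K'} : Finset (Finset Pt)) = opposite T K E := by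
      ext K'
      rw [mem_opposite, Finset.mem_filter]
      constructor
      · rintro ⟨hK', hr⟩
        refine ⟨hK', hsub _ hr.1, ?_⟩
        rintro rfl
        exact lt_asymm hneg (hright.1 hr)
      · rintro ⟨hK', hEK', hne⟩
        obtain ⟨c', e, hc', h0⟩ := exists_eq_triple (htri K' hK') hEeq hcard hEK'
        refine ⟨hK', (isRightOf_iff hp (hedge _ hEK') hc').2 ?_⟩
        by_contra hn
        exact hne (hsame K' hK' c' e
          (mul_pos_of_neg_of_neg hneg (lt_of_le_of_ne (not_lt.1 hn) h0))).symm
    left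
    rw [h1, h2, Finset.sum_singleton]
    split_ifs <;> simp
  · have hb : ¬ IsBoundaryEdge Ω E := fun hb => lt_asymm hpos (hleft.1 (hout hb K hK hE))
    have h1 : ({K' ∈ T | IsRightOf p E K'} : Finset (Finset Pt)) = {K} := by
      ext K'
      simp only [Finset.mem_filter, Finset.mem_singleton]
      constructor
      · rintro ⟨hK', hl⟩
        obtain ⟨c', e, hc', -⟩ := exists_eq_triple (htri K' hK') hEeq hcard (hsub _ hl.1)
        exact (hsame K' hK' c' e (mul_pos hpos ((isRightOf_iff hp hl.1 hc').1 hl))).symm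
      · rintro rfl; exact ⟨hK, hright.2 hpos⟩
    have h2 : ({K' ∈ T | IsLeftOf p E K'} : Finset (Finset Pt)) = opposite T K E := by
      ext K'
      rw [mem_opposite, Finset.mem_filter]
      constructor
      · rintro ⟨hK', hr⟩
        refine ⟨hK', hsub _ hr.1, ?_⟩
        rintro rfl
        exact lt_asymm hpos (hleft.1 hr)
      · rintro ⟨hK', hEK', hne⟩
        obtain ⟨c', e, hc', h0⟩ := exists_eq_triple (htri K' hK') hEeq hcard hEK'
        refine ⟨hK', (isLeftOf_iff hp (hedge _ hEK') hc').2 ?_⟩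
        by_contra hn
        exact hne (hsame K' hK' c' e
          (mul_pos hpos (lt_of_le_of_ne (not_lt.1 hn) h0.symm))).symm
    right
    rw [h1, h2, Finset.sum_singleton, if_neg hb, if_neg hb, neg_sub]

/-! ### Reverse triangle inequalities for squares -/

/-- `X`, `Y`, `D` behave like the squared norms of two vectors and of their difference. -/
structure SqClose (X Y D : ℝ) : Prop where
  left_nonneg : 0 ≤ X
  right_nonneg : 0 ≤ Y
  abs_le : |Real.sqrt X - Real.sqrt Y| ≤ Real.sqrt D

theorem SqClose.mono {X Y D D' : ℝ} (h : SqClose X Y D) (hD : D ≤ D') : SqClose X Y D' :=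
  ⟨h.1, h.2, h.3.trans (Real.sqrt_le_sqrt hD)⟩

theorem SqClose.zero : SqClose 0 0 0 := ⟨le_rfl, le_rfl, by simp⟩

theorem SqClose.mul_left {X Y D c : ℝ} (h : SqClose X Y D) (hc : 0 ≤ c) :
    SqClose (c * X) (c * Y) (c * D) := by
  refine ⟨mul_nonneg hc h.1, mul_nonneg hc h.2, ?_⟩
  rw [Real.sqrt_mul hc, Real.sqrt_mul hc, Real.sqrt_mul hc, ← mul_sub, abs_mul,
    abs_of_nonneg (Real.sqrt_nonneg c)]
  exact mul_le_mul_of_nonneg_left h.3 (Real.sqrt_nonneg c)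

/-- This is the reverse triangle inequality in the Euclidean plane for $(\sqrt X,\sqrt{X'})$ and
$(\sqrt Y,\sqrt{Y'})$. -/
theorem SqClose.add {X Y D X' Y' D' : ℝ} (h : SqClose X Y D) (h' : SqClose X' Y' D')
    (hD : 0 ≤ D) (hD' : 0 ≤ D') : SqClose (X + X') (Y + Y') (D + D') := by
  refine ⟨add_nonneg h.1 h'.1, add_nonneg h.2 h'.2, ?_⟩
  have e : ∀ a b : ℝ, 0 ≤ a → 0 ≤ b →
      Real.sqrt (a + b) = ‖(!₂[Real.sqrt a, Real.sqrt b] : Pt)‖ := fun a b ha hb => by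
    rw [EuclideanSpace.norm_eq]; simp [Real.sq_sqrt, ha, hb]
  rw [e _ _ h.1 h'.1, e _ _ h.2 h'.2]
  refine (abs_norm_sub_norm_le _ _).trans ?_
  rw [EuclideanSpace.norm_eq]
  refine Real.sqrt_le_sqrt ?_
  have k := (sq_le_sq₀ (abs_nonneg _) (Real.sqrt_nonneg D)).2 h.3
  have k' := (sq_le_sq₀ (abs_nonneg _) (Real.sqrt_nonneg D')).2 h'.3
  rw [Real.sq_sqrt hD] at k
  rw [Real.sq_sqrt hD'] at k'
  simp only [Fin.sum_univ_two, Real.norm_eq_abs]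
  exact add_le_add (by simpa using k) (by simpa using k')

theorem SqClose.sum {ι : Type*} {X Y D : ι → ℝ} (s : Finset ι)
    (h : ∀ i ∈ s, SqClose (X i) (Y i) (D i)) (hD : ∀ i ∈ s, 0 ≤ D i) :
    SqClose (∑ i ∈ s, X i) (∑ i ∈ s, Y i) (∑ i ∈ s, D i) := by
  induction s using Finset.induction_on with
  | empty => simpa using SqClose.zero
  | insert i s hi ih =>
    rw [Finset.sum_insert hi, Finset.sum_insert hi, Finset.sum_insert hi]
    have hD' : ∀ j ∈ s, 0 ≤ D j := fun j hj => hD j (Finset.mem_insert_of_mem hj)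
    exact (h i (Finset.mem_insert_self i s)).add
      (ih (fun j hj => h j (Finset.mem_insert_of_mem hj)) hD')
      (hD i (Finset.mem_insert_self i s)) (Finset.sum_nonneg hD')

theorem sqClose_integral {α : Type*} [MeasurableSpace α] {μ : Measure α} {F G : α → ℝ}
    (hF : MemLp F 2 μ) (hG : MemLp G 2 μ) :
    SqClose (∫ x, F x ^ 2 ∂μ) (∫ x, G x ^ 2 ∂μ) (∫ x, (F x - G x) ^ 2 ∂μ) := by
  have key : ∀ {H : α → ℝ} (hH : MemLp H 2 μ), Real.sqrt (∫ x, H x ^ 2 ∂μ) = ‖hH.toLp‖ := by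
    intro H hH
    rw [Real.sqrt_eq_iff_mul_self_eq (integral_nonneg fun _ => sq_nonneg _) (norm_nonneg _),
      ← real_inner_self_eq_norm_mul_norm, L2.inner_def]
    refine integral_congr_ae ?_
    filter_upwards [hH.coeFn_toLp] with x hx
    simp [hx, sq]
  refine ⟨integral_nonneg fun _ => sq_nonneg _, integral_nonneg fun _ => sq_nonneg _, ?_⟩
  have h3 := key (hF.sub hG)
  simp only [Pi.sub_apply] at h3
  rw [key hF, key hG, h3, MemLp.toLp_sub hF hG]
  exact abs_norm_sub_norm_le _ _

/-! ### Edge integrals -/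

theorem edgeIntegral_swap (p : Pt × Pt) (g : Pt → ℝ) :
    edgeIntegral p.swap g = edgeIntegral p g := by
  unfold edgeIntegral
  rw [Prod.fst_swap, Prod.snd_swap, dist_comm]
  congr 1
  have h := intervalIntegral.integral_comp_sub_left
    (fun s => g (AffineMap.lineMap p.1 p.2 s)) (a := 0) (b := 1) (1 : ℝ)
  simp only [sub_self, sub_zero] at h
  rw [← h]
  congr 1
  ext s
  rw [AffineMap.lineMap_apply_one_sub]

theorem tangent_swap (p : Pt × Pt) : tangent p.swap = -tangent p := by
  simp only [tangent, Prod.fst_swap, Prod.snd_swap]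
  rw [dist_comm, ← smul_neg, neg_sub]

theorem normal_swap (p : Pt × Pt) : normal p.swap = -normal p := by
  ext i; fin_cases i <;> simp [normal, tangent_swap]

/-- The inequality includes coinciding endpoints, for which the tangent is zero. -/
theorem norm_tangent_le (p : Pt × Pt) : ‖tangent p‖ ≤ 1 := by
  rw [tangent, norm_smul, dist_eq_norm, norm_inv, norm_norm, norm_sub_rev]
  exact inv_mul_le_one

theorem norm_normal_le (p : Pt × Pt) : ‖normal p‖ ≤ 1 := by
  have h : ‖normal p‖ ^ 2 = ‖tangent p‖ ^ 2 := by
    rw [normSq_eq, normSq_eq]; simp [normal]; ring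
  rw [(sq_eq_sq₀ (norm_nonneg _) (norm_nonneg _)).1 h]
  exact norm_tangent_le p

theorem lineMap_mem_hull {p : Pt × Pt} {K : Finset Pt} (h1 : p.1 ∈ K) (h2 : p.2 ∈ K) {s : ℝ}
    (hs : s ∈ Icc (0 : ℝ) 1) : AffineMap.lineMap p.1 p.2 s ∈ hull K :=
  (convex_hull K).lineMap_mem (subset_hull K h1) (subset_hull K h2) hs

theorem edgeIntegral_congr {p : Pt × Pt} {g g' : Pt → ℝ} (h : ∀ x ∈ hull {p.1, p.2}, g x = g' x) :
    edgeIntegral p g = edgeIntegral p g' := by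
  unfold edgeIntegral
  congr 1
  refine intervalIntegral.integral_congr fun s hs => h _ (lineMap_mem_hull (by simp) (by simp) ?_)
  rwa [uIcc_of_le zero_le_one] at hs

theorem continuous_lineMap_pt (p : Pt × Pt) :
    Continuous fun s : ℝ => (AffineMap.lineMap p.1 p.2 s : Pt) := AffineMap.lineMap_continuous

theorem sqClose_edgeIntegral (p : Pt × Pt) {g g' : Pt → Pt} (hg : Continuous g)
    (hg' : Continuous g') {n : Pt} (hn : ‖n‖ ≤ 1) :
    SqClose (edgeIntegral p fun x => inner ℝ (g x) n ^ 2)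
      (edgeIntegral p fun x => inner ℝ (g' x) n ^ 2)
      (edgeIntegral p fun x => ‖g x - g' x‖ ^ 2) := by
  have hl := continuous_lineMap_pt p
  have hm : ∀ {h : Pt → Pt}, Continuous h →
      MemLp (fun s : ℝ => inner ℝ (h (AffineMap.lineMap p.1 p.2 s)) n) 2
        (volume.restrict (Ioc (0 : ℝ) 1)) := by
    intro h hh
    have hc : Continuous fun s : ℝ => inner ℝ (h (AffineMap.lineMap p.1 p.2 s)) n :=
      (hh.comp hl).inner continuous_const
    obtain ⟨C, hC⟩ := isCompact_Icc.exists_bound_of_continuousOn (s := Icc (0 : ℝ) 1)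
      hc.continuousOn
    exact MemLp.of_bound hc.aestronglyMeasurable C ((ae_restrict_iff' measurableSet_Ioc).2
      (ae_of_all _ fun s hs => hC s (Ioc_subset_Icc_self hs)))
  have h := (sqClose_integral (hm hg) (hm hg')).mul_left (dist_nonneg (x := p.1) (y := p.2))
  simp only [edgeIntegral, intervalIntegral.integral_of_le zero_le_one]
  refine h.mono (mul_le_mul_of_nonneg_left ?_ dist_nonneg)
  simp only [← inner_sub_left]
  refine integral_mono_of_nonneg (ae_of_all _ fun _ => sq_nonneg _) ?_ (ae_of_all _ fun s => ?_)
  · have hc : Continuous fun s : ℝ => ‖g (AffineMap.lineMap p.1 p.2 s) -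
        g' (AffineMap.lineMap p.1 p.2 s)‖ ^ 2 := ((hg.comp hl).sub (hg'.comp hl)).norm.pow 2
    exact (hc.continuousOn.integrableOn_compact isCompact_Icc).mono_set Ioc_subset_Icc_self
  · have h1 := abs_real_inner_le_norm
      (g (AffineMap.lineMap p.1 p.2 s) - g' (AffineMap.lineMap p.1 p.2 s)) n
    simp only
    rw [← sq_abs]
    gcongr
    exact h1.trans (mul_le_of_le_one_right (norm_nonneg _) hn)

theorem edgeIntegral_le (p : Pt × Pt) {g : Pt → ℝ} (hg : Continuous g) {M : ℝ}
    (h : ∀ x ∈ hull {p.1, p.2}, g x ≤ M) : edgeIntegral p g ≤ dist p.1 p.2 * M := by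
  refine mul_le_mul_of_nonneg_left ?_ dist_nonneg
  have h2 := intervalIntegral.integral_mono_on (μ := volume) (g := fun _ => M) zero_le_one
    ((hg.comp (continuous_lineMap_pt p)).intervalIntegrable 0 1)
    intervalIntegrable_const
    (fun s hs => h _ (lineMap_mem_hull (by simp) (by simp) hs))
  simpa using h2

/-! ### Inverse estimates on regular triangles -/

theorem abs_cross_le (u w : Pt) : |cross u w| ≤ ‖u‖ * ‖w‖ := by
  apply abs_le_of_sq_le_sq _ (by positivity)
  rw [mul_pow, normSq_eq, normSq_eq, cross]
  nlinarith [sq_nonneg (u 0 * w 0 + u 1 * w 1)]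

theorem integral_norm_gradPoly_sq (r : MvPolynomial (Fin 2) ℝ) (K : Finset Pt) :
    ∫ x in interior (hull K), ‖gradPoly r x‖ ^ 2 =
      ∑ i, ∫ x in interior (hull K), evalPoly (MvPolynomial.pderiv i r) x ^ 2 := by
  simp only [norm_gradPoly_sq]
  exact integral_finsetSum _ fun i _ =>
    integrableOn_interior_hull K ((continuous_evalPoly _).pow 2)

theorem exists_gradPoly_bound (k : ℕ) :
    ∃ C : ℝ, 0 < C ∧ ∀ r : MvPolynomial (Fin 2) ℝ, r.totalDegree ≤ k → ∀ K, IsTriangle K →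
      ∀ x ∈ hull K, area K * ‖gradPoly r x‖ ^ 2 ≤
        C * ∫ x in interior (hull K), ‖gradPoly r x‖ ^ 2 := by
  obtain ⟨C, hC, h⟩ := exists_pointwise_bound k
  refine ⟨volume.real refTriangle * C, mul_pos refArea_pos hC, fun r hr K hK x hx => ?_⟩
  obtain ⟨a, b, c, rfl, h0⟩ := hK.exists_eq
  rw [integral_norm_gradPoly_sq, norm_gradPoly_sq, area_triple, mul_comm |_|, mul_assoc, mul_assoc]
  refine mul_le_mul_of_nonneg_left ?_ refArea_pos.le
  rw [Finset.mul_sum, Finset.mul_sum]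
  exact Finset.sum_le_sum fun i _ => (h _ (totalDegree_pderiv_le i hr) a b c h0 x hx).1

/-- No side of a regular triangle is short: the area is at most a constant times $|p-q|\,|c-p|$, and
$|c-p|^2\le C|K|$; squaring and cancelling one factor $|K|$ gives the claim. -/
theorem area_le_of_isRegular {C : ℝ} {K : Finset Pt} (hK : IsTriangle K)
    (hreg : IsRegular C K) {p q : Pt} (hp : p ∈ K) (hq : q ∈ K) (hpq : p ≠ q) :
    area K ≤ (volume.real refTriangle) ^ 2 * C * ‖p - q‖ ^ 2 := by
  obtain ⟨c, hc, -, -⟩ := exists_eq_triple hK (E := {p, q}) rfl (Finset.card_pair hpq)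
    (by intro x hx; simp at hx; rcases hx with rfl | rfl <;> assumption)
  have h1 := hreg c (by rw [hc]; simp) p hp
  have h2 := abs_cross_le (q - p) (c - p)
  have hV := refArea_pos
  have hA := area_pos_of_interior_nonempty hK.interior_nonempty
  have h3 : area K = |cross (q - p) (c - p)| * volume.real refTriangle := by
    rw [hc, area_triple]
  rw [norm_sub_rev q p] at h2
  set V := (volume : Measure Pt).real refTriangle
  have h4 : area K ^ 2 ≤ area K * (V ^ 2 * C * ‖p - q‖ ^ 2) := by
    calc area K ^ 2 = (|cross (q - p) (c - p)| * V) ^ 2 := by rw [h3]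
      _ ≤ (‖p - q‖ * ‖c - p‖ * V) ^ 2 := by gcongr
      _ = ‖p - q‖ ^ 2 * V ^ 2 * ‖c - p‖ ^ 2 := by ring
      _ ≤ ‖p - q‖ ^ 2 * V ^ 2 * (C * area K) := by gcongr
      _ = _ := by ring
  rw [sq] at h4
  exact le_of_mul_le_mul_left h4 hA

/-- The weight belongs to `K`, the gradient to a possibly different triangle `K'`. The common side
$E$ links them through $|K|^{1/2}\lesssim|E|$ and $|E|^2\lesssim|K'|$. -/
theorem exists_trace_bound (k : ℕ) {C₀ : ℝ} (hC₀ : 0 < C₀) :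
    ∃ C : ℝ, 0 < C ∧ ∀ r : MvPolynomial (Fin 2) ℝ, r.totalDegree ≤ k →
      ∀ K K' : Finset Pt, IsTriangle K → IsTriangle K' → IsRegular C₀ K → IsRegular C₀ K' →
      ∀ p q : Pt, p ≠ q → p ∈ K → q ∈ K → p ∈ K' → q ∈ K' → ∀ x ∈ hull K',
        Real.sqrt (area K) * (dist p q * ‖gradPoly r x‖ ^ 2) ≤
          C * ∫ x in interior (hull K'), ‖gradPoly r x‖ ^ 2 := by
  obtain ⟨C, hC, h⟩ := exists_gradPoly_bound k
  have hV := refArea_pos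
  set V := (volume : Measure Pt).real refTriangle
  refine ⟨V * Real.sqrt C₀ * C₀ * C, by positivity, ?_⟩
  intro r hr K K' hK hK' hreg hreg' p q hpq hp hq hp' hq' x hx
  have h1 := h r hr K' hK' x hx
  have h2 := hreg' p hp' q hq'
  have h3 := area_le_of_isRegular hK hreg hp hq hpq
  have h4 : Real.sqrt (area K) ≤ V * Real.sqrt C₀ * ‖p - q‖ := by
    rw [Real.sqrt_le_left (by positivity)]
    rw [mul_pow, mul_pow, Real.sq_sqrt hC₀.le]
    exact h3
  rw [dist_eq_norm]
  calc Real.sqrt (area K) * (‖p - q‖ * ‖gradPoly r x‖ ^ 2)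
      ≤ V * Real.sqrt C₀ * ‖p - q‖ * (‖p - q‖ * ‖gradPoly r x‖ ^ 2) := by gcongr
    _ = V * Real.sqrt C₀ * (‖p - q‖ ^ 2 * ‖gradPoly r x‖ ^ 2) := by ring
    _ ≤ V * Real.sqrt C₀ * (C₀ * area K' * ‖gradPoly r x‖ ^ 2) := by gcongr
    _ = V * Real.sqrt C₀ * C₀ * (area K' * ‖gradPoly r x‖ ^ 2) := by ring
    _ ≤ V * Real.sqrt C₀ * C₀ * (C * ∫ x in interior (hull K'), ‖gradPoly r x‖ ^ 2) := by gcongr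
    _ = _ := by ring

/-- The derivative bound of `exists_pointwise_bound`, applied to $\partial_ir$, gives
$|K|^2(\partial_i^2r)^2\lesssim\|\partial_ir\|_K^2$ pointwise. Integration over $K$ supplies one
factor $|K|$, the weight the other. -/
theorem exists_laplacian_bound (k : ℕ) {C₀ : ℝ} (hC₀ : 0 < C₀) :
    ∃ C : ℝ, 0 < C ∧ ∀ r : MvPolynomial (Fin 2) ℝ, r.totalDegree ≤ k →
      ∀ K : Finset Pt, IsTriangle K → IsRegular C₀ K →
        area K * ∫ x in interior (hull K), evalPoly (lapPoly r) x ^ 2 ≤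
          C * ∫ x in interior (hull K), ‖gradPoly r x‖ ^ 2 := by
  obtain ⟨C, hC, h⟩ := exists_pointwise_bound k
  have hV := refArea_pos
  set V := (volume : Measure Pt).real refTriangle with hVdef
  refine ⟨2 * (V ^ 2 * (C * (2 * C₀ * V))), by positivity, ?_⟩
  intro r hr K hK hreg
  have hA := area_pos_of_interior_nonempty hK.interior_nonempty
  have hpt : ∀ x ∈ interior (hull K), evalPoly (lapPoly r) x ^ 2 ≤
      2 * (V ^ 2 * (C * (2 * C₀ * V))) / area K ^ 2 *
        ∫ x in interior (hull K), ‖gradPoly r x‖ ^ 2 := by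
    intro x hx
    rw [integral_norm_gradPoly_sq]
    have key : ∀ i, area K ^ 2 * evalPoly (MvPolynomial.pderiv i (MvPolynomial.pderiv i r)) x ^ 2 ≤
        V ^ 2 * (C * (2 * C₀ * V)) *
          ∫ x in interior (hull K), evalPoly (MvPolynomial.pderiv i r) x ^ 2 := by
      intro i
      obtain ⟨a, b, c, rfl, h0⟩ := hK.exists_eq
      have h1 := (h _ (totalDegree_pderiv_le i hr) a b c h0 x (interior_subset hx)).2 i
      have h2 := hreg b (by simp) a (by simp)
      have h3 := hreg c (by simp) a (by simp)
      rw [area_triple, ← hVdef] at h2 h3 ⊢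
      set D := |cross (b - a) (c - a)|
      have hD : 0 < D := abs_pos.2 h0
      set I := ∫ x in interior (hull {a, b, c}), evalPoly (MvPolynomial.pderiv i r) x ^ 2
      have hI : 0 ≤ I := integral_nonneg fun _ => sq_nonneg _
      set Q := evalPoly (MvPolynomial.pderiv i (MvPolynomial.pderiv i r)) x ^ 2
      have h4 : D * (D ^ 2 * Q) ≤ D * (C * (2 * C₀ * V) * I) := by
        calc D * (D ^ 2 * Q) = D ^ 3 * Q := by ring
          _ ≤ C * (‖b - a‖ ^ 2 + ‖c - a‖ ^ 2) * I := h1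
          _ ≤ C * (C₀ * (D * V) + C₀ * (D * V)) * I := by gcongr
          _ = _ := by ring
      have h5 := le_of_mul_le_mul_left h4 hD
      calc (D * V) ^ 2 * Q = V ^ 2 * (D ^ 2 * Q) := by ring
        _ ≤ V ^ 2 * (C * (2 * C₀ * V) * I) := by gcongr
        _ = _ := by ring
    rw [div_mul_eq_mul_div, le_div_iff₀ (by positivity), Fin.sum_univ_two]
    have e : evalPoly (lapPoly r) x =
        evalPoly (MvPolynomial.pderiv 0 (MvPolynomial.pderiv 0 r)) x +
        evalPoly (MvPolynomial.pderiv 1 (MvPolynomial.pderiv 1 r)) x := by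
      simp [lapPoly, evalPoly]
    rw [e]
    have k0 := key 0
    have k1 := key 1
    set a := evalPoly (MvPolynomial.pderiv 0 (MvPolynomial.pderiv 0 r)) x
    set b := evalPoly (MvPolynomial.pderiv 1 (MvPolynomial.pderiv 1 r)) x
    calc (a + b) ^ 2 * area K ^ 2 ≤ (2 * (a ^ 2 + b ^ 2)) * area K ^ 2 := by
          gcongr; linarith [sq_nonneg (a - b)]
      _ = 2 * (area K ^ 2 * a ^ 2 + area K ^ 2 * b ^ 2) := by ring
      _ ≤ _ := by linarith
  set G := ∫ x in interior (hull K), ‖gradPoly r x‖ ^ 2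
  set M := 2 * (V ^ 2 * (C * (2 * C₀ * V)))
  have hM : 0 < M := by positivity
  have hG : 0 ≤ G := integral_nonneg fun _ => sq_nonneg _
  have hvol : (volume : Measure Pt).real (interior (hull K)) ≤ area K :=
    measureReal_mono interior_subset (volume_hull_ne_top K)
  have hfin : (volume : Measure Pt) (interior (hull K)) ≠ ⊤ :=
    ((measure_mono interior_subset).trans_lt (volume_hull_ne_top K).lt_top).ne
  have hint : ∫ x in interior (hull K), evalPoly (lapPoly r) x ^ 2 ≤
      area K * (M / area K ^ 2 * G) := by
    calc ∫ x in interior (hull K), evalPoly (lapPoly r) x ^ 2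
        ≤ ∫ _ in interior (hull K), M / area K ^ 2 * G :=
          setIntegral_mono_on (integrableOn_interior_hull K ((continuous_evalPoly _).pow 2))
            (integrableOn_const hfin) isOpen_interior.measurableSet hpt
      _ = (volume : Measure Pt).real (interior (hull K)) * (M / area K ^ 2 * G) := by simp
      _ ≤ _ := by gcongr
  calc area K * ∫ x in interior (hull K), evalPoly (lapPoly r) x ^ 2
      ≤ area K * (area K * (M / area K ^ 2 * G)) := by gcongr
    _ = M * G := by field_simp

/-! ### Traces and jumps of broken gradients -/

/-- A convex set with nonempty interior is in the closure of that interior, so the limit defining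
the extension exists on the whole triangle and is the value of `g`. -/
theorem restr_eq {F : Type*} [NormedAddCommGroup F] {K : Finset Pt} (hK : IsTriangle K)
    {u g : Pt → F} (hg : Continuous g) (h : ∀ x ∈ interior (hull K), u x = g x) {x : Pt}
    (hx : x ∈ hull K) : restr K u x = g x := by
  refine extendFrom_eq ?_ ?_
  · rw [(convex_hull K).closure_interior_eq_closure_of_nonempty_interior hK.interior_nonempty]
    exact subset_closure hx
  · refine (hg.continuousAt.tendsto.mono_left nhdsWithin_le_nhds).congr' ?_
    filter_upwards [self_mem_nhdsWithin] with y hy using (h y hy).symm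

/-- `P` selects the polynomials of degree at most `k` that `v` consists of. -/
def IsPieces (T : Finset (Finset Pt)) (k : ℕ) (v : Pt → ℝ)
    (P : Finset Pt → MvPolynomial (Fin 2) ℝ) : Prop :=
  ∀ K ∈ T, (P K).totalDegree ≤ k ∧ ∀ x ∈ interior (hull K), v x = evalPoly (P K) x

theorem exists_isPieces {T : Finset (Finset Pt)} {k : ℕ} {v : Pt → ℝ} (hv : v ∈ piecewisePoly T k) :
    ∃ P, IsPieces T k v P := by
  have h : ∀ K : Finset Pt, ∃ p : MvPolynomial (Fin 2) ℝ, K ∈ T →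
      p.totalDegree ≤ k ∧ ∀ x ∈ interior (hull K), v x = evalPoly p x := by
    intro K
    by_cases hK : K ∈ T
    · obtain ⟨p, hp⟩ := hv K hK
      exact ⟨p, fun _ => hp⟩
    · exact ⟨0, fun h => absurd h hK⟩
  choose P hP using h
  exact ⟨P, hP⟩

theorem eventuallyEq_of_mem_interior {k : ℕ} {T : Finset (Finset Pt)} {v : Pt → ℝ}
    {P : Finset Pt → MvPolynomial (Fin 2) ℝ} (hP : IsPieces T k v P) {K : Finset Pt} (hK : K ∈ T)
    {x : Pt} (hx : x ∈ interior (hull K)) : v =ᶠ[𝓝 x] evalPoly (P K) :=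
  Filter.eventuallyEq_of_mem (isOpen_interior.mem_nhds hx) (hP K hK).2

theorem laplacian_eq_lapPoly {k : ℕ} {T : Finset (Finset Pt)} {v : Pt → ℝ}
    {P : Finset Pt → MvPolynomial (Fin 2) ℝ} (hP : IsPieces T k v P) {K : Finset Pt} (hK : K ∈ T)
    {x : Pt} (hx : x ∈ interior (hull K)) :
    Laplacian.laplacian v x = evalPoly (lapPoly (P K)) x := by
  rw [← laplacian_evalPoly]
  exact (InnerProductSpace.laplacian_congr_nhds (eventuallyEq_of_mem_interior hP hK hx)).self_of_nhds

theorem brokenGrad_eq_gradPoly {k : ℕ} {T : Finset (Finset Pt)} {v : Pt → ℝ}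
    {P : Finset Pt → MvPolynomial (Fin 2) ℝ} (hP : IsPieces T k v P) {K : Finset Pt} (hK : K ∈ T)
    {x : Pt} (hx : x ∈ interior (hull K)) : brokenGrad T v x = gradPoly (P K) x := by
  rw [brokenGrad, indicator_of_mem (mem_iUnion₂.2 ⟨K, hK, hx⟩), ← gradient_evalPoly]
  exact Filter.EventuallyEq.gradient_eq (eventuallyEq_of_mem_interior hP hK hx)

/-- Square integrability is needed to bound `l2Norm` from below by the contributions of the
triangles: a non-integrable function would have integral zero by convention. -/
theorem memLp_brokenGrad {k : ℕ} {T : Finset (Finset Pt)} (hT : IsConforming T)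
    (htri : ∀ K ∈ T, IsTriangle K) {v : Pt → ℝ} {P : Finset Pt → MvPolynomial (Fin 2) ℝ}
    (hP : IsPieces T k v P) : MemLp (brokenGrad T v) 2 volume := by
  have h : brokenGrad T v = ∑ K ∈ T, indicator (interior (hull K)) (gradPoly (P K)) := by
    ext1 x
    rw [Finset.sum_apply]
    by_cases hx : ∃ K ∈ T, x ∈ interior (hull K)
    · obtain ⟨K, hK, hxK⟩ := hx
      rw [brokenGrad_eq_gradPoly hP hK hxK, Finset.sum_eq_single_of_mem K hK,
        indicator_of_mem hxK]
      intro K' hK' hne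
      exact indicator_of_notMem
        (Set.disjoint_right.1 (disjoint_interior_hull hT htri hK' hK hne) hxK) _
    · push Not at hx
      rw [brokenGrad, indicator_of_notMem (by simpa using hx)]
      exact (Finset.sum_eq_zero fun K hK => indicator_of_notMem (hx K hK) _).symm
  rw [h]
  refine memLp_finsetSum' _ fun K _ => ?_
  rw [memLp_indicator_iff_restrict isOpen_interior.measurableSet]
  exact (memLp_restrict_of_continuous (continuous_gradPoly _) (isCompact_hull K)).mono_measure
    (Measure.restrict_mono interior_subset le_rfl)

/-- The polynomial whose gradient is, up to the sign, the jump of the broken gradient over the edge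
`E` of `K`. -/
def jumpPoly (Ω : Set Pt) (T : Finset (Finset Pt)) (P : Finset Pt → MvPolynomial (Fin 2) ℝ)
    (K E : Finset Pt) : MvPolynomial (Fin 2) ℝ :=
  P K - if IsBoundaryEdge Ω E then 0 else ∑ K' ∈ opposite T K E, P K'

theorem gradPoly_zero (x : Pt) : gradPoly 0 x = 0 := by
  ext i; fin_cases i <;> simp [gradPoly, evalPoly]

theorem gradPoly_add (p q : MvPolynomial (Fin 2) ℝ) (x : Pt) :
    gradPoly (p + q) x = gradPoly p x + gradPoly q x := by
  ext i; fin_cases i <;> simp [gradPoly]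

theorem gradPoly_sum {ι : Type*} (s : Finset ι) (P : ι → MvPolynomial (Fin 2) ℝ) (x : Pt) :
    gradPoly (∑ i ∈ s, P i) x = ∑ i ∈ s, gradPoly (P i) x :=
  map_sum (⟨⟨fun p => gradPoly p x, gradPoly_zero x⟩, fun p q => gradPoly_add p q x⟩ :
    MvPolynomial (Fin 2) ℝ →+ Pt) P s

theorem jump_brokenGrad {k : ℕ} {Ω : Set Pt} {T : Finset (Finset Pt)} {σ : Finset Pt → Pt × Pt}
    (hT : IsConforming T) (htri : ∀ K ∈ T, IsTriangle K) (hσ : IsNumbering Ω T σ) {v : Pt → ℝ}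
    {P : Finset Pt → MvPolynomial (Fin 2) ℝ} (hP : IsPieces T k v P) {K E : Finset Pt}
    (hK : K ∈ T) (hE : E ∈ edgesOf K) {x : Pt} (hx : x ∈ hull E) :
    jump Ω T σ (brokenGrad T v) E x = gradPoly (jumpPoly Ω T P K E) x ∨
      jump Ω T σ (brokenGrad T v) E x = -gradPoly (jumpPoly Ω T P K E) x := by
  have hr : ∀ K' ∈ T, E ⊆ K' → restr K' (brokenGrad T v) x = gradPoly (P K') x := fun K' hK' hE' =>
    restr_eq (htri K' hK') (continuous_gradPoly _)
      (fun y hy => brokenGrad_eq_gradPoly hP hK' hy)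
      (convexHull_mono (Finset.coe_subset.2 hE') hx)
  have h := jump_eq_or_eq_neg hT htri hσ hK hE (brokenGrad T v) x
  have e : (restr K (brokenGrad T v) x - if IsBoundaryEdge Ω E then 0 else
      ∑ K' ∈ opposite T K E, restr K' (brokenGrad T v) x) = gradPoly (jumpPoly Ω T P K E) x := by
    rw [jumpPoly, gradPoly_sub, hr K hK (Finset.mem_powersetCard.1 hE).1]
    congr 1
    split_ifs
    · rw [gradPoly_zero]
    · rw [gradPoly_sum]
      exact Finset.sum_congr rfl fun K' hK' =>
        hr K' (mem_opposite.1 hK').1 (mem_opposite.1 hK').2.1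
  simpa only [e] using h

theorem eq_or_eq_swap {p p' : Pt × Pt} {E : Finset Pt} (h : E = {p.1, p.2})
    (h' : E = {p'.1, p'.2}) : p' = p ∨ p' = p.swap := by
  have h2 : ({p'.1, p'.2} : Set Pt) = {p.1, p.2} := by
    have := congrArg (fun s : Finset Pt => (s : Set Pt)) (h'.symm.trans h)
    simpa using this
  rcases Set.pair_eq_pair_iff.1 h2 with ⟨h3, h4⟩ | ⟨h3, h4⟩
  · exact Or.inl (Prod.ext h3 h4)
  · exact Or.inr (Prod.ext h3 h4)

/-- The jump terms of the estimator depend neither on the numbering of the edges nor on the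
choice of the adjacent triangle. -/
theorem edgeIntegral_jump_eq {k : ℕ} {Ω : Set Pt} {T : Finset (Finset Pt)}
    {σ : Finset Pt → Pt × Pt} (hT : IsConforming T) (htri : ∀ K ∈ T, IsTriangle K)
    (hσ : IsNumbering Ω T σ) {v : Pt → ℝ} {P : Finset Pt → MvPolynomial (Fin 2) ℝ}
    (hP : IsPieces T k v P) {K E : Finset Pt} (hK : K ∈ T) (hE : E ∈ edgesOf K) {p : Pt × Pt}
    (hp : E = {p.1, p.2}) {n : Pt × Pt → Pt} (hn : ∀ p, n p.swap = -n p) :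
    edgeIntegral (σ E) (fun x => inner ℝ (jump Ω T σ (brokenGrad T v) E x) (n (σ E)) ^ 2) =
      edgeIntegral p (fun x => inner ℝ (gradPoly (jumpPoly Ω T P K E) x) (n p) ^ 2) := by
  have hE' := hσ.endpoints E (Finset.mem_biUnion.2 ⟨K, hK, hE⟩)
  trans edgeIntegral (σ E) (fun x => inner ℝ (gradPoly (jumpPoly Ω T P K E) x) (n (σ E)) ^ 2)
  · refine edgeIntegral_congr fun x hx => ?_
    rw [← hE'] at hx
    rcases jump_brokenGrad hT htri hσ hP hK hE hx with h | h <;> rw [h]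
    rw [inner_neg_left, neg_sq]
  · rcases eq_or_eq_swap hp hE' with h | h
    · rw [h]
    · rw [h, edgeIntegral_swap, hn]
      simp only [inner_neg_right, neg_sq]

/-! ### Integrals over the domain -/

theorem volume_segment (p q : Pt) : (volume : Measure Pt) (segment ℝ p q) = 0 := by
  have h1 : segment ℝ p q = hull {p, q, q} := by
    rw [← convexHull_pair, hull]; simp
  have h2 : area {p, q, q} = 0 := by rw [area_triple, cross_self]; simp
  rw [h1]
  exact (measureReal_eq_zero_iff (volume_hull_ne_top _)).1 h2

theorem IsPolygonalLipschitzDomain.closure_ae_eq {Ω : Set Pt} (hΩ : IsPolygonalLipschitzDomain Ω) :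
    closure Ω =ᵐ[volume] Ω := by
  refine closure_ae_eq_of_null_frontier ?_
  obtain ⟨S, hS⟩ := hΩ.polygonal
  rw [hS]
  exact (measure_biUnion_null_iff S.countable_toSet).2 fun p _ => volume_segment p.1 p.2

theorem sum_integral_interior_le {Ω : Set Pt} (hΩ : IsPolygonalLipschitzDomain Ω)
    {T : Finset (Finset Pt)} (hT : IsConforming T) (htri : ∀ K ∈ T, IsTriangle K)
    (hsub : ∀ K ∈ T, hull K ⊆ closure Ω) {w : Pt → Pt} (hw : MemLp w 2 volume) :
    ∑ K ∈ T, ∫ x in interior (hull K), ‖w x‖ ^ 2 ≤ ∫ x in Ω, ‖w x‖ ^ 2 := by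
  have hint : Integrable (fun x => ‖w x‖ ^ 2) volume := hw.norm.integrable_sq
  rw [← integral_biUnion_finset T (fun K _ => isOpen_interior.measurableSet)
    (fun K hK K' hK' hne => disjoint_interior_hull hT htri hK hK' hne)
    (fun K _ => hint.integrableOn), ← setIntegral_congr_set hΩ.closure_ae_eq]
  exact setIntegral_mono_set hint.integrableOn (ae_of_all _ fun _ => sq_nonneg _)
    (iUnion₂_subset fun K hK => interior_subset.trans (hsub K hK)).eventuallyLE

theorem memLp_restrict_interior_hull {Ω : Set Pt} (hΩ : IsPolygonalLipschitzDomain Ω) {f : Pt → ℝ}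
    (hf : MemLp f 2 (volume.restrict Ω)) {K : Finset Pt} (hK : hull K ⊆ closure Ω) :
    MemLp f 2 (volume.restrict (interior (hull K))) := by
  rw [← Measure.restrict_congr_set hΩ.closure_ae_eq] at hf
  exact hf.mono_measure (Measure.restrict_mono (interior_subset.trans hK) le_rfl)

/-- Being neighbours across `E` is a symmetric relation, so `N K'` may be exchanged for `N K`. Then
each of the three edges of `K` contributes at most once. -/
theorem sum_opposite_le {T : Finset (Finset Pt)} (hT : IsConforming T)
    (htri : ∀ K ∈ T, IsTriangle K) {N : Finset Pt → ℝ} (hN : ∀ K, 0 ≤ N K) :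
    ∑ K ∈ T, ∑ E ∈ edgesOf K, ∑ K' ∈ opposite T K E, N K' ≤ 3 * ∑ K ∈ T, N K := by
  have h1 : ∑ K ∈ T, ∑ E ∈ edgesOf K, ∑ K' ∈ opposite T K E, N K' =
      ∑ K ∈ T, ∑ E ∈ edgesOf K, ∑ _ ∈ opposite T K E, N K := by
    have e : ∀ (K : Finset Pt) (g : Finset Pt → ℝ),
        ∑ E ∈ edgesOf K, ∑ K' ∈ opposite T K E, g K' =
        ∑ K' ∈ T, ∑ _ ∈ edgesOf K ∩ edgesOf K', if K' ≠ K then g K' else 0 := by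
      intro K g
      simp only [opposite, Finset.sum_filter]
      rw [Finset.sum_comm]
      refine Finset.sum_congr rfl fun K' _ => ?_
      have : edgesOf K ∩ edgesOf K' = (edgesOf K).filter (fun E => E ⊆ K') := by
        ext E
        simp only [Finset.mem_inter, Finset.mem_filter, edgesOf, Finset.mem_powersetCard]
        tauto
      rw [this, Finset.sum_filter]
      refine Finset.sum_congr rfl fun E _ => ?_
      split_ifs <;> simp_all
    rw [Finset.sum_congr rfl fun K _ => e K N, Finset.sum_comm,
      Finset.sum_congr rfl fun K _ => e K fun _ => N K]
    refine Finset.sum_congr rfl fun K _ => Finset.sum_congr rfl fun K' _ => ?_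
    rw [Finset.inter_comm]
    refine Finset.sum_congr rfl fun E _ => ?_
    by_cases h : K = K' <;> simp [h, eq_comm]
  rw [h1, Finset.mul_sum]
  refine Finset.sum_le_sum fun K hK => ?_
  have hcard : (edgesOf K).card = 3 := by
    rw [edgesOf, Finset.card_powersetCard, (htri K hK).1]; rfl
  calc ∑ E ∈ edgesOf K, ∑ _ ∈ opposite T K E, N K ≤ ∑ _ ∈ edgesOf K, N K := by
        refine Finset.sum_le_sum fun E hE => ?_
        rw [Finset.sum_const, nsmul_eq_mul]
        have : ((opposite T K E).card : ℝ) ≤ 1 := by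
          exact_mod_cast Finset.card_le_one.2
            fun a ha b hb => opposite_subsingleton hT htri hK hE ha hb
        exact mul_le_of_le_one_left (hN K) this
    _ = 3 * N K := by rw [Finset.sum_const, hcard]; simp

/-! ### Stability of the jumps -/

/-- A conforming mesh of regular triangles. -/
structure IsRegularMesh (C : ℝ) (T : Finset (Finset Pt)) : Prop where
  conforming : IsConforming T
  isTriangle : ∀ K ∈ T, IsTriangle K
  isRegular : ∀ K ∈ T, IsRegular C K

/-- `w` is the difference of the piecewise gradients of `P` on `T` and of `P'` on `T'`. -/
def IsGradDiff (T T' : Finset (Finset Pt)) (P P' : Finset Pt → MvPolynomial (Fin 2) ℝ)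
    (w : Pt → Pt) : Prop :=
  ∀ K ∈ T, ∀ K' ∈ T', hull K' ⊆ hull K →
    ∀ x ∈ interior (hull K'), w x = gradPoly (P K - P' K') x

theorem IsGradDiff.integral_eq {T T' : Finset (Finset Pt)}
    {P P' : Finset Pt → MvPolynomial (Fin 2) ℝ} {w : Pt → Pt} (hw : IsGradDiff T T' P P' w)
    {K K' : Finset Pt} (hK : K ∈ T) (hK' : K' ∈ T') (h : hull K' ⊆ hull K) :
    ∫ x in interior (hull K'), ‖gradPoly (P K - P' K') x‖ ^ 2 =
      ∫ x in interior (hull K'), ‖w x‖ ^ 2 :=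
  setIntegral_congr_fun isOpen_interior.measurableSet fun x hx => by
    simp only [hw K hK K' hK' h x hx]

theorem isGradDiff_brokenGrad {k : ℕ} {T T' : Finset (Finset Pt)} {v v' : Pt → ℝ}
    {P P' : Finset Pt → MvPolynomial (Fin 2) ℝ} (hP : IsPieces T k v P)
    (hP' : IsPieces T' k v' P') :
    IsGradDiff T T' P P' fun x => brokenGrad T v x - brokenGrad T' v' x := by
  intro K hK K' hK' h x hx
  simp only [gradPoly_sub, brokenGrad_eq_gradPoly hP hK (interior_mono h hx),
    brokenGrad_eq_gradPoly hP' hK' hx]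

theorem totalDegree_sub_le {k : ℕ} {p q : MvPolynomial (Fin 2) ℝ} (hp : p.totalDegree ≤ k)
    (hq : q.totalDegree ≤ k) : (p - q).totalDegree ≤ k :=
  (MvPolynomial.totalDegree_sub _ _).trans (max_le hp hq)

theorem gradPoly_jumpPoly {Ω : Set Pt} {T : Finset (Finset Pt)}
    {P : Finset Pt → MvPolynomial (Fin 2) ℝ} {K E : Finset Pt} (x : Pt) :
    gradPoly (jumpPoly Ω T P K E) x = gradPoly (P K) x -
      if IsBoundaryEdge Ω E then 0 else ∑ K' ∈ opposite T K E, gradPoly (P K') x := by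
  rw [jumpPoly, gradPoly_sub]
  split_ifs
  · rw [gradPoly_zero]
  · rw [gradPoly_sum]

/-- The difference of the jumps is $\nabla(P_K-P'_K)-\nabla(P_{K_2}-P'_{K_2'})$ with neighbours
$K_2'\subseteq K_2$ across `E`; the second term is absent if there is no neighbour or `E` is on the
boundary. The two gradients equal $w$ on $K$ and on $K_2'$, and the trace bound applies there. -/
theorem exists_jump_bound (k : ℕ) {C₀ : ℝ} (hC₀ : 0 < C₀) :
    ∃ C : ℝ, 0 < C ∧ ∀ (Ω : Set Pt) (T T' : Finset (Finset Pt)), IsRegularMesh C₀ T →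
      IsRegularMesh C₀ T' → Subdivides T T' →
      ∀ P P' : Finset Pt → MvPolynomial (Fin 2) ℝ, (∀ K ∈ T, (P K).totalDegree ≤ k) →
      (∀ K ∈ T', (P' K).totalDegree ≤ k) → ∀ w, IsGradDiff T T' P P' w →
      ∀ K ∈ T, K ∈ T' → ∀ E ∈ edgesOf K, ∀ p : Pt × Pt, E = {p.1, p.2} →
        Real.sqrt (area K) * edgeIntegral p (fun x =>
          ‖gradPoly (jumpPoly Ω T P K E) x - gradPoly (jumpPoly Ω T' P' K E) x‖ ^ 2) ≤
        C * ((∫ x in interior (hull K), ‖w x‖ ^ 2) +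
          ∑ K' ∈ opposite T' K E, ∫ x in interior (hull K'), ‖w x‖ ^ 2) := by
  obtain ⟨C, hC, h⟩ := exists_trace_bound k hC₀
  refine ⟨2 * C, by linarith, ?_⟩
  intro Ω T T' hT hT' hsub P P' hP hP' w hw K hK hK' E hE p hp
  obtain ⟨hEK, hcard⟩ := Finset.mem_powersetCard.1 hE
  have hne : p.1 ≠ p.2 := fun h => by rw [hp, h] at hcard; simp at hcard
  have hA := area_pos_of_interior_nonempty (hT.isTriangle K hK).interior_nonempty
  have hd : 0 < dist p.1 p.2 := dist_pos.2 hne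
  have hs : 0 < Real.sqrt (area K) := Real.sqrt_pos.2 hA
  have hN : ∀ K, 0 ≤ ∫ x in interior (hull K), ‖w x‖ ^ 2 := fun K =>
    integral_nonneg fun _ => sq_nonneg _
  set R := (∫ x in interior (hull K), ‖w x‖ ^ 2) +
    ∑ K' ∈ opposite T' K E, ∫ x in interior (hull K'), ‖w x‖ ^ 2 with hR
  have htrace : ∀ K₁ ∈ T, ∀ K₂ ∈ T', hull K₂ ⊆ hull K₁ → E ⊆ K₂ → ∀ x ∈ hull E,
      Real.sqrt (area K) * (dist p.1 p.2 * ‖gradPoly (P K₁) x - gradPoly (P' K₂) x‖ ^ 2) ≤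
        C * ∫ x in interior (hull K₂), ‖w x‖ ^ 2 := by
    intro K₁ h₁ K₂ h₂ hle hE₂ x hx
    have hmem : ∀ S : Finset Pt, E ⊆ S → p.1 ∈ S ∧ p.2 ∈ S := fun S hS =>
      ⟨hS (by rw [hp]; simp), hS (by rw [hp]; simp)⟩
    have h3 := h _ (totalDegree_sub_le (hP K₁ h₁) (hP' K₂ h₂)) K K₂ (hT.isTriangle K hK)
      (hT'.isTriangle K₂ h₂) (hT.isRegular K hK) (hT'.isRegular K₂ h₂) p.1 p.2 hne
      (hmem K hEK).1 (hmem K hEK).2 (hmem K₂ hE₂).1 (hmem K₂ hE₂).2 x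
      (convexHull_mono (Finset.coe_subset.2 hE₂) hx)
    rwa [hw.integral_eq h₁ h₂ hle, gradPoly_sub] at h3
  have hpt : ∀ x ∈ hull E, Real.sqrt (area K) * (dist p.1 p.2 *
      ‖gradPoly (jumpPoly Ω T P K E) x - gradPoly (jumpPoly Ω T' P' K E) x‖ ^ 2) ≤
      2 * C * R := by
    intro x hx
    have h0 := htrace K hK K hK' Subset.rfl hEK x hx
    have hsum : 0 ≤ ∑ K' ∈ opposite T' K E, ∫ x in interior (hull K'), ‖w x‖ ^ 2 :=
      Finset.sum_nonneg fun K' _ => hN K'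
    have hsingle : Real.sqrt (area K) * (dist p.1 p.2 *
        ‖gradPoly (P K) x - gradPoly (P' K) x‖ ^ 2) ≤ 2 * C * R := by
      have h1 := mul_nonneg hC.le (hN K)
      have h2 := mul_nonneg hC.le hsum
      rw [hR]; linarith
    rw [gradPoly_jumpPoly, gradPoly_jumpPoly]
    by_cases hb : IsBoundaryEdge Ω E
    · simpa [hb] using hsingle
    · simp only [if_neg hb]
      rcases (opposite T' K E).eq_empty_or_nonempty with he | ⟨K₂', hK₂'⟩
      · have he' : opposite T K E = ∅ := by
          by_contra hn
          have := opposite_nonempty_of_subdivides hT.conforming hT'.conforming hT.isTriangle hsub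
            hK hK' hE (Finset.nonempty_iff_ne_empty.2 hn)
          rw [he] at this
          simp at this
        simpa [he, he'] using hsingle
      · obtain ⟨K₂, hK₂, hle⟩ := exists_opposite_of_subdivides hT.conforming hT'.conforming
          hT.isTriangle hT'.isTriangle hsub hK hK' hEK hK₂'
        have e' : opposite T' K E = {K₂'} := Finset.eq_singleton_iff_unique_mem.2
          ⟨hK₂', fun y hy =>
            opposite_subsingleton hT'.conforming hT'.isTriangle hK' hE hy hK₂'⟩
        have e : opposite T K E = {K₂} := Finset.eq_singleton_iff_unique_mem.2
          ⟨hK₂, fun y hy => opposite_subsingleton hT.conforming hT.isTriangle hK hE hy hK₂⟩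
        have h2 := htrace K₂ (mem_opposite.1 hK₂).1 K₂' (mem_opposite.1 hK₂').1 hle
          (mem_opposite.1 hK₂').2.1 x hx
        rw [hR, e', e, Finset.sum_singleton, Finset.sum_singleton, Finset.sum_singleton,
          sub_sub_sub_comm]
        set A := gradPoly (P K) x - gradPoly (P' K) x
        set B := gradPoly (P K₂) x - gradPoly (P' K₂') x
        have hAB : ‖A - B‖ ^ 2 ≤ 2 * (‖A‖ ^ 2 + ‖B‖ ^ 2) := by
          have h3 : ‖A - B‖ ^ 2 ≤ (‖A‖ + ‖B‖) ^ 2 := by gcongr; exact norm_sub_le A B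
          linarith [sq_nonneg (‖A‖ - ‖B‖)]
        calc Real.sqrt (area K) * (dist p.1 p.2 * ‖A - B‖ ^ 2)
            ≤ Real.sqrt (area K) * (dist p.1 p.2 * (2 * (‖A‖ ^ 2 + ‖B‖ ^ 2))) := by gcongr
          _ = 2 * (Real.sqrt (area K) * (dist p.1 p.2 * ‖A‖ ^ 2) +
              Real.sqrt (area K) * (dist p.1 p.2 * ‖B‖ ^ 2)) := by ring
          _ ≤ _ := by linarith
  have hcont : Continuous fun x => ‖gradPoly (jumpPoly Ω T P K E) x -
      gradPoly (jumpPoly Ω T' P' K E) x‖ ^ 2 :=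
    ((continuous_gradPoly _).sub (continuous_gradPoly _)).norm.pow 2
  -- The trace estimate is pointwise with a bound constant along `E`; integration multiplies it by
  -- the length, which cancels.
  have hbound := edgeIntegral_le p hcont
    (M := 2 * C * R / (Real.sqrt (area K) * dist p.1 p.2)) (fun x hx => by
      rw [le_div_iff₀ (mul_pos hs hd)]
      rw [← hp] at hx
      linarith [hpt x hx])
  calc _ ≤ Real.sqrt (area K) *
        (dist p.1 p.2 * (2 * C * R / (Real.sqrt (area K) * dist p.1 p.2))) := by gcongr
    _ = 2 * C * R := by field_simp

/-! ### Stability of the estimator -/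

theorem lapPoly_sub (p q : MvPolynomial (Fin 2) ℝ) : lapPoly (p - q) = lapPoly p - lapPoly q := by
  simp [lapPoly, Finset.sum_sub_distrib]

/-- The free numbering `τ` allows the estimators of both meshes to be written with the same tangents
and normals, so that their jumps can be subtracted. -/
theorem muSq_add_nuSq_eq {k : ℕ} {Ω : Set Pt} {T : Finset (Finset Pt)} {σ : Finset Pt → Pt × Pt}
    (hT : IsConforming T) (htri : ∀ K ∈ T, IsTriangle K) (hσ : IsNumbering Ω T σ) {v : Pt → ℝ}
    {P : Finset Pt → MvPolynomial (Fin 2) ℝ} (hP : IsPieces T k v P) {K : Finset Pt} (hK : K ∈ T)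
    (f : Pt → ℝ) {τ : Finset Pt → Pt × Pt} (hτ : ∀ E ∈ edgesOf K, E = {(τ E).1, (τ E).2}) :
    muSq Ω T σ f v K + nuSq Ω T σ v K =
      area K * (∫ x in interior (hull K), (f x + evalPoly (lapPoly (P K)) x) ^ 2)
      + Real.sqrt (area K) * (∑ E ∈ edgesOf K with ¬ IsBoundaryEdge Ω E,
        edgeIntegral (τ E)
          (fun x => inner ℝ (gradPoly (jumpPoly Ω T P K E) x) (normal (τ E)) ^ 2))
      + Real.sqrt (area K) * ∑ E ∈ edgesOf K, edgeIntegral (τ E)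
          (fun x => inner ℝ (gradPoly (jumpPoly Ω T P K E) x) (tangent (τ E)) ^ 2) := by
  rw [muSq, nuSq]
  congr 2
  · congr 1
    refine setIntegral_congr_fun isOpen_interior.measurableSet fun x hx => ?_
    simp only [laplacian_eq_lapPoly hP hK hx]
  · congr 1
    refine Finset.sum_congr rfl fun E hE => ?_
    have hE' := (Finset.mem_filter.1 hE).1
    exact edgeIntegral_jump_eq hT htri hσ hP hK hE' (hτ E hE') normal_swap
  · exact Finset.sum_congr rfl fun E hE =>
      edgeIntegral_jump_eq hT htri hσ hP hK hE (hτ E hE) tangent_swap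

theorem exists_stability (k : ℕ) {C₀ : ℝ} (hC₀ : 0 < C₀) :
    ∃ Λ : ℝ, 0 < Λ ∧ ∀ (Ω : Set Pt), IsPolygonalLipschitzDomain Ω →
      ∀ T T' : Finset (Finset Pt), IsRegularMesh C₀ T → IsRegularMesh C₀ T' → Subdivides T T' →
      (∀ K ∈ T, hull K ⊆ closure Ω) → (∀ K ∈ T', hull K ⊆ closure Ω) →
      ∀ σ σ' : Finset Pt → Pt × Pt, IsNumbering Ω T σ → IsNumbering Ω T' σ' →
      ∀ f : Pt → ℝ, MemLp f 2 (volume.restrict Ω) →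
      ∀ v ∈ piecewisePoly T k, ∀ v' ∈ piecewisePoly T' k,
        |eta Ω T σ f v (T ∩ T') - eta Ω T' σ' f v' (T ∩ T')| ≤
          Λ * l2Norm Ω (fun x => brokenGrad T v x - brokenGrad T' v' x) := by
  obtain ⟨C₁, hC₁, hvol⟩ := exists_laplacian_bound k hC₀
  obtain ⟨C₂, hC₂, hjump⟩ := exists_jump_bound k hC₀
  -- Each of the three edges of a triangle enters through a normal and a tangential term, which
  -- gives $6C_2$ for the triangle itself. The neighbours add another $6C_2$ by `sum_opposite_le`.
  refine ⟨Real.sqrt (C₁ + 12 * C₂), by positivity, ?_⟩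
  intro Ω hΩ T T' hT hT' hsub hcl hcl' σ σ' hσ hσ' f hf v hv v' hv'
  obtain ⟨P, hP⟩ := exists_isPieces hv
  obtain ⟨P', hP'⟩ := exists_isPieces hv'
  have hw := isGradDiff_brokenGrad hP hP'
  have hwLp : MemLp (fun x => brokenGrad T v x - brokenGrad T' v' x) 2 volume :=
    (memLp_brokenGrad hT.conforming hT.isTriangle hP).sub
      (memLp_brokenGrad hT'.conforming hT'.isTriangle hP')
  set w := fun x => brokenGrad T v x - brokenGrad T' v' x
  set N : Finset Pt → ℝ := fun K => ∫ x in interior (hull K), ‖w x‖ ^ 2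
  have hN : ∀ K, 0 ≤ N K := fun K => integral_nonneg fun _ => sq_nonneg _
  have hO : ∀ K E, 0 ≤ ∑ K' ∈ opposite T' K E, N K' := fun K E =>
    Finset.sum_nonneg fun K' _ => hN K'
  have hlocal : ∀ K ∈ T ∩ T', SqClose (muSq Ω T σ f v K + nuSq Ω T σ v K)
      (muSq Ω T' σ' f v' K + nuSq Ω T' σ' v' K)
      (C₁ * N K + ∑ E ∈ edgesOf K, 2 * (C₂ * (N K + ∑ K' ∈ opposite T' K E, N K'))) := by
    intro K hKK
    obtain ⟨hK, hK'⟩ := Finset.mem_inter.1 hKK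
    have hτ : ∀ E ∈ edgesOf K, E = {(σ E).1, (σ E).2} := fun E hE =>
      hσ.endpoints E (Finset.mem_biUnion.2 ⟨K, hK, hE⟩)
    rw [muSq_add_nuSq_eq hT.conforming hT.isTriangle hσ hP hK f hτ,
      muSq_add_nuSq_eq hT'.conforming hT'.isTriangle hσ' hP' hK' f hτ]
    have hpoly : ∀ p : MvPolynomial (Fin 2) ℝ,
        MemLp (evalPoly p) 2 (volume.restrict (interior (hull K))) := fun p =>
      (memLp_restrict_of_continuous (continuous_evalPoly p) (isCompact_hull K)).mono_measure
        (Measure.restrict_mono interior_subset le_rfl)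
    have hfK := memLp_restrict_interior_hull hΩ hf (hcl K hK)
    have hV : SqClose
        (area K * ∫ x in interior (hull K), (f x + evalPoly (lapPoly (P K)) x) ^ 2)
        (area K * ∫ x in interior (hull K), (f x + evalPoly (lapPoly (P' K)) x) ^ 2)
        (C₁ * N K) := by
      refine ((sqClose_integral (hfK.add (hpoly (lapPoly (P K))))
        (hfK.add (hpoly (lapPoly (P' K))))).mul_left (area_nonneg K)).mono ?_
      simp only [Pi.add_apply, add_sub_add_left_eq_sub, ← evalPoly_sub, ← lapPoly_sub]
      refine (hvol _ (totalDegree_sub_le (hP K hK).1 (hP' K hK').1) K (hT.isTriangle K hK)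
        (hT.isRegular K hK)).trans ?_
      rw [hw.integral_eq hK hK' Subset.rfl]
    have hedge : ∀ n : Pt × Pt → Pt, (∀ p, ‖n p‖ ≤ 1) → ∀ E ∈ edgesOf K, SqClose
        (Real.sqrt (area K) * edgeIntegral (σ E)
          (fun x => inner ℝ (gradPoly (jumpPoly Ω T P K E) x) (n (σ E)) ^ 2))
        (Real.sqrt (area K) * edgeIntegral (σ E)
          (fun x => inner ℝ (gradPoly (jumpPoly Ω T' P' K E) x) (n (σ E)) ^ 2))
        (C₂ * (N K + ∑ K' ∈ opposite T' K E, N K')) := fun n hn E hE =>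
      ((sqClose_edgeIntegral (σ E) (continuous_gradPoly _) (continuous_gradPoly _)
        (hn (σ E))).mul_left (Real.sqrt_nonneg _)).mono
        (hjump Ω T T' hT hT' hsub P P' (fun K hK => (hP K hK).1) (fun K hK => (hP' K hK).1) w hw
          K hK hK' E hE (σ E) (hτ E hE))
    have hD : ∀ E, 0 ≤ C₂ * (N K + ∑ K' ∈ opposite T' K E, N K') := fun E =>
      mul_nonneg hC₂.le (add_nonneg (hN K) (hO K E))
    have hnormal := SqClose.sum ((edgesOf K).filter fun E => ¬ IsBoundaryEdge Ω E)
      (fun E hE => hedge normal norm_normal_le E (Finset.mem_filter.1 hE).1) (fun E _ => hD E)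
    have htangent := SqClose.sum (edgesOf K) (fun E hE => hedge tangent norm_tangent_le E hE)
      (fun E _ => hD E)
    simp only [← Finset.mul_sum] at hnormal htangent
    have hfilter : ∑ E ∈ edgesOf K with ¬ IsBoundaryEdge Ω E,
          (N K + ∑ K' ∈ opposite T' K E, N K') ≤
        ∑ E ∈ edgesOf K, (N K + ∑ K' ∈ opposite T' K E, N K') :=
      Finset.sum_le_sum_of_subset_of_nonneg (Finset.filter_subset _ _)
        fun E _ _ => add_nonneg (hN K) (hO K E)
    have hnn : ∀ s : Finset (Finset Pt),
        0 ≤ C₂ * ∑ E ∈ s, (N K + ∑ K' ∈ opposite T' K E, N K') := fun s =>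
      mul_nonneg hC₂.le (Finset.sum_nonneg fun E _ => add_nonneg (hN K) (hO K E))
    refine ((hV.add hnormal (mul_nonneg hC₁.le (hN K)) (hnn _)).add htangent
      (add_nonneg (mul_nonneg hC₁.le (hN K)) (hnn _)) (hnn _)).mono ?_
    simp only [← Finset.mul_sum]
    have := mul_le_mul_of_nonneg_left hfilter hC₂.le
    linarith
  have hloc0 : ∀ K, 0 ≤ C₁ * N K +
      ∑ E ∈ edgesOf K, 2 * (C₂ * (N K + ∑ K' ∈ opposite T' K E, N K')) := fun K =>
    add_nonneg (mul_nonneg hC₁.le (hN K)) (Finset.sum_nonneg fun E _ =>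
      mul_nonneg zero_le_two (mul_nonneg hC₂.le (add_nonneg (hN K) (hO K E))))
  have htotal := (SqClose.sum (T ∩ T') hlocal (fun K _ => hloc0 K)).abs_le
  refine htotal.trans ?_
  rw [l2Norm, ← Real.sqrt_mul (by positivity)]
  refine Real.sqrt_le_sqrt ?_
  have hcard : ∀ K ∈ T', (edgesOf K).card = 3 := fun K hK => by
    rw [edgesOf, Finset.card_powersetCard, (hT'.isTriangle K hK).1]; rfl
  have hopp := sum_opposite_le hT'.conforming hT'.isTriangle hN
  have hΩle := sum_integral_interior_le hΩ hT'.conforming hT'.isTriangle hcl' hwLp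
  -- Neighbours of common triangles may be refined ones, so the sum is extended to the whole fine
  -- mesh before the overlaps are counted.
  calc _ ≤ ∑ K ∈ T', (C₁ * N K +
        ∑ E ∈ edgesOf K, 2 * (C₂ * (N K + ∑ K' ∈ opposite T' K E, N K'))) :=
        Finset.sum_le_sum_of_subset_of_nonneg Finset.inter_subset_right fun K _ _ => hloc0 K
    _ = ∑ K ∈ T', ((C₁ + 6 * C₂) * N K +
        2 * C₂ * ∑ E ∈ edgesOf K, ∑ K' ∈ opposite T' K E, N K') := by
        refine Finset.sum_congr rfl fun K hK => ?_
        rw [← Finset.mul_sum, ← Finset.mul_sum, Finset.sum_add_distrib, Finset.sum_const,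
          hcard K hK, nsmul_eq_mul]
        push_cast
        ring
    _ = (C₁ + 6 * C₂) * ∑ K ∈ T', N K +
        2 * C₂ * ∑ K ∈ T', ∑ E ∈ edgesOf K, ∑ K' ∈ opposite T' K E, N K' := by
        rw [Finset.sum_add_distrib, Finset.mul_sum, Finset.mul_sum]
    _ ≤ (C₁ + 6 * C₂) * ∑ K ∈ T', N K + 2 * C₂ * (3 * ∑ K ∈ T', N K) := by gcongr
    _ = (C₁ + 12 * C₂) * ∑ K ∈ T', N K := by ring
    _ ≤ _ := mul_le_mul_of_nonneg_left hΩle (by positivity)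

/-! ### Uniform regularity of the refinements and conclusion -/

theorem IsRegular.mono {C C' : ℝ} {K : Finset Pt} (h : IsRegular C K) (hC : C ≤ C') :
    IsRegular C' K := fun x hx y hy =>
  (h x hx y hy).trans (mul_le_mul_of_nonneg_right hC (area_nonneg K))

theorem MarkedMesh.IsSkew.isRegularMesh {C C' : ℝ} {M : MarkedMesh} (h : M.IsSkew C)
    (hM : IsConforming M.elements) (hC : 4 * C / (volume : Measure Pt).real refTriangle ≤ C') :
    IsRegularMesh C' M.elements :=
  ⟨hM, fun K hK => (h K hK).isTriangle, fun K hK => (h K hK).isRegular.mono hC⟩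

theorem hull_subset_of_subdivides {T T' : Finset (Finset Pt)} (h : Subdivides T T') {S : Set Pt}
    (hT : ∀ K ∈ T, hull K ⊆ S) : ∀ K ∈ T', hull K ⊆ S := by
  intro K hK
  obtain ⟨K', hK', hle⟩ := h.1 K hK
  exact hle.trans (hT K' hK')

end CRFEM

end

theorem mainTheorem2 (k : ℕ) (hk : Odd k) (γ : ℝ) :
    ∃ Λ : ℝ, 0 < Λ ∧
      ∀ (Ω : Set CRFEM.Pt), CRFEM.IsPolygonalLipschitzDomain Ω →
      ∀ (M₀ : CRFEM.MarkedMesh), CRFEM.IsTriangulation Ω M₀.elements → M₀.IsMarking →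
        CRFEM.shapeRegularity M₀.elements ≤ γ →
      ∀ (M M' : CRFEM.MarkedMesh),
        CRFEM.IsAdmissibleRefinement M₀ M → CRFEM.IsAdmissibleRefinement M M' →
      ∀ (σ σ' : Finset CRFEM.Pt → CRFEM.Pt × CRFEM.Pt),
        CRFEM.IsNumbering Ω M.elements σ → CRFEM.IsNumbering Ω M'.elements σ' →
      ∀ (f : CRFEM.Pt → ℝ), MemLp f 2 (volume.restrict Ω) →
      ∀ v ∈ CRFEM.CRZero Ω M.elements σ k, ∀ v' ∈ CRFEM.CRZero Ω M'.elements σ' k,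
        |CRFEM.eta Ω M.elements σ f v (M.elements ∩ M'.elements)
            - CRFEM.eta Ω M'.elements σ' f v' (M.elements ∩ M'.elements)|
          ≤ Λ * CRFEM.l2Norm Ω
              (fun x => CRFEM.brokenGrad M.elements v x - CRFEM.brokenGrad M'.elements v' x) := by
  open CRFEM in
  set C := 2 * (4 * γ ^ 2 / Real.pi) * (volume : Measure Pt).real refTriangle
  have hV := refArea_pos
  -- The summand 1 keeps the regularity constant positive when `γ = 0`.
  have hC₀ : 0 < 4 * C / (volume : Measure Pt).real refTriangle + 1 := by positivity
  obtain ⟨Λ, hΛ, h⟩ := exists_stability k hC₀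
  refine ⟨Λ, hΛ, ?_⟩
  intro Ω hΩ M₀ hM₀ hmark hγ M M' hM hM' σ σ' hσ hσ' f hf v hv v' hv'
  have hskew := isSkew_of_reflTransGen hM.1 (isSkew_of_isTriangulation hM₀ hmark hγ)
  -- The second refinement inherits the constant of the initial mesh, without any loss from the
  -- intermediate one.
  have hskew' := isSkew_of_reflTransGen hM'.1 hskew
  have hsub := subdivides_of_reflTransGen hM'.1
  have hcl₀ : ∀ K ∈ M₀.elements, hull K ⊆ closure Ω := fun K hK => by
    rw [← hM₀.covers]; exact subset_biUnion_of_mem (u := hull) hK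
  have hcl := hull_subset_of_subdivides (subdivides_of_reflTransGen hM.1) hcl₀
  exact h Ω hΩ M.elements M'.elements (hskew.isRegularMesh hM.2 (by linarith))
    (hskew'.isRegularMesh hM'.2 (by linarith)) hsub hcl (hull_subset_of_subdivides hsub hcl)
    σ σ' hσ hσ' f hf v hv.1 v' hv'.1
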